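/- **Setting.** Let $C$ be a stabilizer circuit on $m$ qubits (gates $H,S,CZ,X,Y,Z,\mathrm{CNOT}$), run on input $|0^m\rangle$. Its polynomial $q_C$ over $\mathbb{Z}_4$ is built gate by gate. Line $i$ starts with annotation $u_i=x_i$. A Hadamard gate on line $i$ adds $2u_iy$ with a new variable $y$ and sets $u_i:=y$; $S$ adds $u_i$; $CZ$ on $i,j$ adds $2u_iu_j$; $X$ sets $u_i:=1-u_i$; $Z$ adds $2u_i$; $Y$ adds $2u_i$ and sets $u_i:=1-u_i$; $\mathrm{CNOT}$ with control $i$ and target $j$ sets $u_j:=u_i+u_j-2u_iu_j$. At the end of line $j$, either the last annotation is a single Hadamard variable (a different one for each such line), which is identified with the output variable $z_j$, or a fresh variable $w_j$ is introduced and $2w_j(u_j-z_j)$ is added. Set $R^2=2^{h+2t}$, where $h$ is the number of Hadamard gates and $t$ the number of variables $w_j$. Put $x=0$, and let $\vec y=(y_1,\dots,y_n)$ be the variables other than $z$ that remain, in some order. Suppose that, for all bit vectors $\vec y,\vec b$ and up to a term not depending on $\vec y$ (a global phase), $$q_C(\vec y,\vec b)=\vec y^\top A\vec y+2\,\vec y^\top\Delta_b\,\vec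 y \pmod 4,$$ where $A$ is a symmetric $n\times n$ matrix over $\mathbb{Z}_4$ and $\Delta_b$ is the diagonal matrix with $b_j$ at a place $\mathrm{pos}(j)$ and zeros elsewhere, $\mathrm{pos}$ being injective. (For instance, if a fresh $w_j$ is used on every line, $\mathrm{pos}(j)$ is the place of $w_j$.) Call $q_C$ alternating if the main diagonal of $A$ is zero modulo $2$. **Theorem.** Suppose that we know an invertible matrix $Q$ over $\mathbb{F}_2$ and matrices $D_1,D_2$ with entries in $\{0,1\}$ such that $\vec y^\top Q^\top AQ\,\vec y=\vec y^\top(D_1+2D_2)\vec y \pmod 4$ for all $\vec y\in\{0,1\}^n$, where * if $q_C$ is alternating, $D_2$ is diagonal and $D_1=M\oplus\cdots\oplus M\oplus 0$ consists of $g$ blocks $M=\begin{bmatrix}0&1\\1&0\end{bmatrix}$ followed by zeros, so that $D_1$ has rank $r=2g$ over $\mathbb{F}_2$; * if $q_C$ is non-alternating, $D_1$ and $D_2$ are both diagonal, and $r$ is the rank of $D_1$. Then $|\langle \vec b|C|\vec 0\rangle|^2$ can be computed for any output vector $\vec b\in\{0,1\}^m$ in $O((e+1)n+1)$ time, where $e$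 is the number of ones in $\vec b$; for $e,n\ge 1$ this is $O(en)$. More precisely, let $$w_k=(D_2)_{kk}+\sum_{j:\,b_j=1}Q_{\mathrm{pos}(j),k}\pmod 2 \qquad (1\le k\le n).$$ Then $|\langle \vec b|C|\vec 0\rangle|^2=0$ if and only if $w_k=1$ for some $k$ such that row $k$ of $D_1$ is zero, and otherwise $|\langle \vec b|C|\vec 0\rangle|^2=2^{2n-r}/R^2$. Moreover, there are a single word-RAM program (unit-cost addition, truncated subtraction, indirect array access and tests on words, no multiplication) and a constant $K$ such that for all such data the program, given $n$, $m$, the exponent $h+2t$ of $R^2$, $Q$, $D_1$, $D_2$, $\vec b$ and $\mathrm{pos}$, halts after at most $K\bigl((e+1)n+1\bigr)$ steps with the exact value of $|\langle \vec b|C|\vec 0\rangle|^2$, written as $0$ or as the exponent $k$ of $2^{-k}$. Here the word bound may be any integer $\ge K(n+1)^2$, so that words of $O(\log (n+2))$ bits suffice. -/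

import Mathlib

/-! ### Stabilizer circuits and their amplitudes

A basis state of `m` qubits is a bit vector `Fin m → ZMod 2`. -/

namespace Stabilizer

/-- Clifford gates on `m` qubit lines. -/
inductive Gate (m : ℕ) : Type
  | H (i : Fin m) : Gate m
  | S (i : Fin m) : Gate m
  | CZ (i j : Fin m) (hij : i ≠ j) : Gate m
  | X (i : Fin m) : Gate m
  | Y (i : Fin m) : Gate m
  | Z (i : Fin m) : Gate m
  /-- control `i`, target `j` -/
  | CNOT (i j : Fin m) (hij : i ≠ j) : Gate m

/-- A circuit is the list of its gates, the first one being applied first. -/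
abbrev Circuit (m : ℕ) : Type := List (Gate m)

/-- The `2 × 2` matrix `M` acting on line `i`, tensored with the identity on the other lines. -/
def onLine {m : ℕ} (i : Fin m) (M : ZMod 2 → ZMod 2 → ℂ) :
    Matrix (Fin m → ZMod 2) (Fin m → ZMod 2) ℂ :=
  Matrix.of fun r c => if ∀ l, l ≠ i → r l = c l then M (r i) (c i) else 0

/-- The `4 × 4` matrix `M` acting on the pair of lines `(i, j)`, tensored with the identity. -/
def onLines {m : ℕ} (i j : Fin m) (M : ZMod 2 × ZMod 2 → ZMod 2 × ZMod 2 → ℂ) :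
    Matrix (Fin m → ZMod 2) (Fin m → ZMod 2) ℂ :=
  Matrix.of fun r c =>
    if ∀ l, l ≠ i → l ≠ j → r l = c l then M (r i, r j) (c i, c j) else 0

/-- The unitary matrix of a gate (rows are outputs, columns are inputs). -/
noncomputable def Gate.unitary {m : ℕ} : Gate m →
    Matrix (Fin m → ZMod 2) (Fin m → ZMod 2) ℂ
  | .H i => onLine i fun r c => (if r = 1 ∧ c = 1 then -1 else 1) / (Real.sqrt 2 : ℂ)
  | .S i => onLine i fun r c => if r = c then (if c = 1 then Complex.I else 1) else 0
  | .CZ i j _ => onLines i j fun r c =>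
      if r = c then (if c.1 = 1 ∧ c.2 = 1 then -1 else 1) else 0
  | .X i => onLine i fun r c => if r = c + 1 then 1 else 0
  | .Y i => onLine i fun r c =>
      if r = c + 1 then (if c = 1 then -Complex.I else Complex.I) else 0
  | .Z i => onLine i fun r c => if r = c then (if c = 1 then -1 else 1) else 0
  | .CNOT i j _ => onLines i j fun r c => if r = (c.1, c.1 + c.2) then 1 else 0

/-- The unitary matrix of a circuit. -/
noncomputable def Circuit.unitary {m : ℕ} : Circuit m →
    Matrix (Fin m → ZMod 2) (Fin m → ZMod 2) ℂ
  | [] => 1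
  | g :: C => Circuit.unitary C * g.unitary

/-- The amplitude `⟨b|C|a⟩`. -/
noncomputable def amplitude {m : ℕ} (C : Circuit m) (b a : Fin m → ZMod 2) : ℂ :=
  Circuit.unitary C b a

/-! ### The additive partition polynomial `q_C` over `ℤ/4` -/

/-- Inputs `x`, nondeterministic variables `y`, output-equating variables `w`, outputs `z`. -/
inductive PVar (m : ℕ) : Type
  | x (i : Fin m) : PVar m
  | y (k : ℕ) : PVar m
  | w (j : Fin m) : PVar m
  | z (j : Fin m) : PVar m

/-- The number of `y`-variables allocated so far, the current annotation of every line,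
and the current polynomial. -/
structure BuildState (m : ℕ) where
  count : ℕ
  ann : Fin m → MvPolynomial (PVar m) (ZMod 4)
  poly : MvPolynomial (PVar m) (ZMod 4)

/-- The rule of each gate.  `Y` is treated as `X Z`, its global scalar `i` being ignored. -/
noncomputable def BuildState.step {m : ℕ} (s : BuildState m) : Gate m → BuildState m
  | .H i =>
      { count := s.count + 1
        ann := Function.update s.ann i (MvPolynomial.X (PVar.y s.count))
        poly := s.poly + 2 * s.ann i * MvPolynomial.X (PVar.y s.count) }
  | .S i => { s with poly := s.poly + s.ann i }
  | .CZ i j _ => { s with poly := s.poly + 2 * s.ann i * s.ann j }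
  | .X i => { s with ann := Function.update s.ann i (1 - s.ann i) }
  | .Y i =>
      { s with
        ann := Function.update s.ann i (1 - s.ann i)
        poly := s.poly + 2 * s.ann i }
  | .Z i => { s with poly := s.poly + 2 * s.ann i }
  | .CNOT i j _ =>
      { s with
        ann := Function.update s.ann j (s.ann i + s.ann j - 2 * s.ann i * s.ann j) }

/-- Process the whole circuit, line `i` being annotated by `x_i` at the start. -/
noncomputable def build {m : ℕ} (C : Circuit m) : BuildState m :=
  C.foldl BuildState.step
    { count := 0, ann := fun i => MvPolynomial.X (PVar.x i), poly := 0 }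

/-- How the output variables are attached to the ends of the qubit lines.
If `var j = some k` then the last annotation of line `j` is the single variable `y_k`, which is
identified with `z_j`; if `var j = none` then a fresh variable `w_j` is used to equate the last
annotation of line `j` with `z_j`. -/
structure OutputChoice {m : ℕ} (C : Circuit m) where
  var : Fin m → Option (Fin (build C).count)
  valid : ∀ j k, var j = some k → (build C).ann j = MvPolynomial.X (PVar.y (k : ℕ))
  inj : ∀ j j' k, var j = some k → var j' = some k → j = j'

/-- The polynomial `q_C`, before the identifications and substitutions. -/
noncomputable def OutputChoice.poly {m : ℕ} {C : Circuit m} (o : OutputChoice C) :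
    MvPolynomial (PVar m) (ZMod 4) :=
  (build C).poly + ∑ j : {j : Fin m // o.var j = none},
    2 * MvPolynomial.X (PVar.w j.1) * ((build C).ann j.1 - MvPolynomial.X (PVar.z j.1))

/-- The variables that remain free when inputs and outputs are fixed:
the `y_k` that are not identified with an output, and the `w_j` that are in use. -/
abbrev OutputChoice.FreeVar {m : ℕ} {C : Circuit m} (o : OutputChoice C) : Type :=
  {k : Fin (build C).count // ∀ j, o.var j ≠ some k} ⊕ {j : Fin m // o.var j = none}

/-- A bit as an element of `{0, 1} ⊆ ℤ/4`. -/
def liftBit (a : ZMod 2) : ZMod 4 := (a.val : ZMod 4)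

/-- The assignment given by input `0`, output `b` and the values `v` of the free variables. -/
noncomputable def OutputChoice.assign {m : ℕ} {C : Circuit m} (o : OutputChoice C)
    (v : o.FreeVar → ZMod 2) (b : Fin m → ZMod 2) : PVar m → ZMod 4
  | .x _ => 0
  | .z j => liftBit (b j)
  | .w j => if h : o.var j = none then liftBit (v (Sum.inr ⟨j, h⟩)) else 0
  | .y k =>
      if hk : k < (build C).count then
        if h : ∃ j, o.var j = some ⟨k, hk⟩ then liftBit (b h.choose)
        else liftBit (v (Sum.inl ⟨⟨k, hk⟩, fun j hj => h ⟨j, hj⟩⟩))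
      else 0

/-- The value `q_C(v, b)` on input `0`, for bit vectors `v` (free variables) and `b` (output). -/
noncomputable def OutputChoice.value {m : ℕ} {C : Circuit m} (o : OutputChoice C)
    (v : o.FreeVar → ZMod 2) (b : Fin m → ZMod 2) : ZMod 4 :=
  MvPolynomial.eval (o.assign v b) o.poly

/-- `ρ` such that the divisor `R` in `⟨b|C|0⟩ = R⁻¹ ∑_v i ^ q_C(v,b)` (up to a global phase)
satisfies `R² = 2 ^ ρ`: one factor `√2` for every Hadamard gate, one factor `2` for every `w_j`. -/
noncomputable def OutputChoice.normExp {m : ℕ} {C : Circuit m} (o : OutputChoice C) : ℕ :=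
  (build C).count + 2 * Fintype.card {j : Fin m // o.var j = none}

/-! ### Classical quadratic forms -/

/-- `yᵀ A y` over `ℤ/4`, for a bit vector `y`. -/
def quadForm {n : ℕ} (A : Matrix (Fin n) (Fin n) (ZMod 4)) (y : Fin n → ZMod 2) : ZMod 4 :=
  (fun i => liftBit (y i)) ⬝ᵥ (A.mulVec fun i => liftBit (y i))

/-- The form `yᵀ A y` is alternating when the main diagonal of `A` vanishes modulo `2`. -/
def IsAlternating {n : ℕ} (A : Matrix (Fin n) (Fin n) (ZMod 4)) : Prop :=
  ∀ i, A i i = 0 ∨ A i i = 2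

/-- The `n × n` matrix `M ⊕ ⋯ ⊕ M ⊕ 0` with `g` blocks `M = [0 1; 1 0]` followed by zeros. -/
def blockMatrix (n g : ℕ) : Matrix (Fin n) (Fin n) (ZMod 2) :=
  Matrix.of fun k l =>
    if ∃ j < g, ((k : ℕ) = 2 * j ∧ (l : ℕ) = 2 * j + 1) ∨ ((k : ℕ) = 2 * j + 1 ∧ (l : ℕ) = 2 * j)
    then 1 else 0

/-- `q_C(y, b) = yᵀ A y + 2 yᵀ Δ_b y` for all bit vectors `y` and `b`, up to a term not depending
on `y` (a global phase).  Here `A` is symmetric and `Δ_b` is the diagonal matrix that has the entry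
`b_j` at place `pos j` and zeros elsewhere; `ord` is the order chosen on the free variables. -/
def OutputChoice.IsPresentedBy {m n : ℕ} {C : Circuit m} (o : OutputChoice C)
    (ord : Fin n ≃ o.FreeVar) (A : Matrix (Fin n) (Fin n) (ZMod 4)) (pos : Fin m → Fin n) : Prop :=
  A.IsSymm ∧ Function.Injective pos ∧
    ∃ c : (Fin m → ZMod 2) → ZMod 4, ∀ (b : Fin m → ZMod 2) (y : Fin n → ZMod 2),
      o.value (fun u => y (ord.symm u)) b =
        quadForm A y + 2 * ∑ j, liftBit (b j) * liftBit (y (pos j)) + c b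

/-- `Q` is an invertible matrix over `𝔽₂` with `yᵀ Qᵀ A Q y = yᵀ (D₁ + 2 D₂) y` over `ℤ/4`
for all bit vectors `y`, where `D₁` and `D₂` have the shape of the normal form. -/
def IsNormalForm {n : ℕ} (A : Matrix (Fin n) (Fin n) (ZMod 4))
    (Q D₁ D₂ : Matrix (Fin n) (Fin n) (ZMod 2)) : Prop :=
  IsUnit Q.det ∧
  (∀ y : Fin n → ZMod 2,
    quadForm ((Q.map liftBit).transpose * A * Q.map liftBit) y =
      quadForm (D₁.map liftBit + 2 • D₂.map liftBit) y) ∧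
  D₂.IsDiag ∧
  (IsAlternating A → ∃ g, 2 * g ≤ n ∧ D₁ = blockMatrix n g) ∧
  (¬ IsAlternating A → D₁.IsDiag)

/-- The updated linear part `w = diag(D₂ + ∑ E_i)`, the sum running over the `i` at which `Δ_b` has
a one, where `E_i` is the diagonal matrix made of row `i` of `Q`. -/
def linearPart {m n : ℕ} (Q D₂ : Matrix (Fin n) (Fin n) (ZMod 2)) (pos : Fin m → Fin n)
    (b : Fin m → ZMod 2) (k : Fin n) : ZMod 2 :=
  D₂ k k + ∑ j, b j * Q (pos j) k

/-- The number of ones of a bit vector. -/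
def numOnes {m : ℕ} (b : Fin m → ZMod 2) : ℕ := (Finset.univ.filter fun j => b j = 1).card

/-! ### A word RAM

Registers and array cells hold words, that is, natural numbers below the word bound `W`.  A program
names finitely many registers and arrays; every elementary instruction and every test costs one
step.  There is no multiplication. -/

structure RAMState where
  reg : ℕ → ℕ
  arr : ℕ → ℕ → ℕ

inductive Prog : Type
  | skip : Prog
  /-- `reg d := v` -/
  | const (d v : ℕ) : Prog
  /-- `reg d := reg s` -/
  | copy (d s : ℕ) : Prog
  /-- `reg d := reg s + reg t` (modulo the word bound) -/
  | add (d s t : ℕ) : Prog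
  /-- `reg d := reg s - reg t` (zero if negative) -/
  | sub (d s t : ℕ) : Prog
  /-- `reg d := arr a [reg s]` -/
  | load (d a s : ℕ) : Prog
  /-- `arr a [reg d] := reg s` -/
  | store (a d s : ℕ) : Prog
  | seq (p q : Prog) : Prog
  /-- if `reg r ≠ 0` then `p` else `q` -/
  | cond (r : ℕ) (p q : Prog) : Prog
  /-- while `reg r ≠ 0` do `p` -/
  | loop (r : ℕ) (p : Prog) : Prog

def RAMState.setReg (s : RAMState) (d v : ℕ) : RAMState :=
  { s with reg := Function.update s.reg d v }

def RAMState.setArr (s : RAMState) (a i v : ℕ) : RAMState :=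
  { s with arr := Function.update s.arr a (Function.update (s.arr a) i v) }

/-- `Exec W p s t s'`: with word bound `W`, program `p` started in state `s` halts after exactly `t`
steps in state `s'`. -/
inductive Exec (W : ℕ) : Prog → RAMState → ℕ → RAMState → Prop
  | skip (s : RAMState) : Exec W .skip s 1 s
  | const (d v : ℕ) (s : RAMState) : Exec W (.const d v) s 1 (s.setReg d (v % W))
  | copy (d r : ℕ) (s : RAMState) : Exec W (.copy d r) s 1 (s.setReg d (s.reg r))
  | add (d r r' : ℕ) (s : RAMState) :
      Exec W (.add d r r') s 1 (s.setReg d ((s.reg r + s.reg r') % W))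
  | sub (d r r' : ℕ) (s : RAMState) :
      Exec W (.sub d r r') s 1 (s.setReg d (s.reg r - s.reg r'))
  | load (d a r : ℕ) (s : RAMState) :
      Exec W (.load d a r) s 1 (s.setReg d (s.arr a (s.reg r)))
  | store (a d r : ℕ) (s : RAMState) :
      Exec W (.store a d r) s 1 (s.setArr a (s.reg d) (s.reg r))
  | seq {p q : Prog} {s s₁ s₂ : RAMState} {t₁ t₂ : ℕ} :
      Exec W p s t₁ s₁ → Exec W q s₁ t₂ s₂ → Exec W (.seq p q) s (t₁ + t₂) s₂
  | cond_true {r : ℕ} {p q : Prog} {s s₁ : RAMState} {t : ℕ} :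
      s.reg r ≠ 0 → Exec W p s t s₁ → Exec W (.cond r p q) s (t + 1) s₁
  | cond_false {r : ℕ} {p q : Prog} {s s₁ : RAMState} {t : ℕ} :
      s.reg r = 0 → Exec W q s t s₁ → Exec W (.cond r p q) s (t + 1) s₁
  | loop_done {r : ℕ} {p : Prog} {s : RAMState} :
      s.reg r = 0 → Exec W (.loop r p) s 1 s
  | loop_step {r : ℕ} {p : Prog} {s s₁ s₂ : RAMState} {t₁ t₂ : ℕ} :
      s.reg r ≠ 0 → Exec W p s t₁ s₁ → Exec W (.loop r p) s₁ t₂ s₂ →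
      Exec W (.loop r p) s (t₁ + t₂ + 1) s₂

/-- An `n × n` bit matrix as an array, row by row: entry `(i, j)` is stored at `i * n + j`. -/
def matrixArray {n : ℕ} (M : Matrix (Fin n) (Fin n) (ZMod 2)) (a : ℕ) : ℕ :=
  if h : a / n < n ∧ a % n < n then (M ⟨a / n, h.1⟩ ⟨a % n, h.2⟩).val else 0

/-- A vector of naturals as an array. -/
def vectorArray {m : ℕ} (v : Fin m → ℕ) (a : ℕ) : ℕ := if h : a < m then v ⟨a, h⟩ else 0

/-- The input of the algorithm: registers `0, 1, 2` hold `n`, `m` and the exponent of `R²`; arrays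
`0, …, 4` hold `Q`, `D₁`, `D₂`, `b` and the places `pos j`.  All other cells are zero. -/
def inputState {m n : ℕ} (ρ : ℕ) (Q D₁ D₂ : Matrix (Fin n) (Fin n) (ZMod 2)) (b : Fin m → ZMod 2)
    (pos : Fin m → Fin n) : RAMState where
  reg
    | 0 => n
    | 1 => m
    | 2 => ρ
    | _ => 0
  arr
    | 0 => matrixArray Q
    | 1 => matrixArray D₁
    | 2 => matrixArray D₂
    | 3 => vectorArray fun j => (b j).val
    | 4 => vectorArray fun j => (pos j : ℕ)
    | _ => fun _ => 0

/-- The number written in a final state: `0` if register `0` holds `0`, otherwise `2 ^ (-k)`, where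
`k` is the content of register `1`. -/
noncomputable def outputValue (s : RAMState) : ℝ :=
  if s.reg 0 = 0 then 0 else ((2 : ℝ) ^ s.reg 1)⁻¹

end Stabilizer

/-! The amplitude is a path sum. Every gate except the Hadamard gate permutes basis states up to a
power of `i`, and a Hadamard gate introduces one summation bit with weight `(-1)^(u y) / √2`. Hence,
by induction on the circuit (`isPathSum_build`), the output state is a sum of `i ^ q` over the
Hadamard bits. Summing over `w_j` forces line `j` to end in `b_j` and contributes a factor 2, so up
to a phase the amplitude is `R⁻¹ ∑ i ^ q_C` (`OutputChoice.amplitude_eq`).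

A symmetric form over ℤ/4 depends only on its argument modulo 2 (`dotProduct_mulVec_congr`). The
bijection `y ↦ Q y` of bit vectors therefore turns the exponent into `yᵀ D₁ y + 2 w·y`. Both shapes
of `D₁` are adjacency matrices of partial involutions, so one argument covers both: `D₁²` is the
diagonal projection onto the nonzero rows, which gives the kernel and the rank. In the squared
modulus of the sum, put `x = y + z`. Summing over `y` leaves `2^n` times the sum over the `z` in the
kernel of `D₁`, where the exponent is linear. This remaining sum of `(-1)^(w·z)` is `2^(n-r)`, or 0
if `w` is one at some zero row (`norm_sum_sq`).

The program adds one row of `Q` to `diag D₂` for each one of `b`, at cost `O(n)` per row even though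
the row address must be found by repeated addition. A row of `D₁` is tested for zero by three
entries, because the involution moves no index by more than one (`rowWeight_eq_zero_iff`). The
exponent is `ρ + r - 2n`; unitarity bounds the amplitude by 1, so this truncated subtraction is
exact. Words stay small because `ρ = n + m ≤ 2n`. -/

namespace Stabilizer

/-! ### Powers of `i`, signs, and bits inside ℤ/4 -/

/-- `i ^ a` for `a` in `ℤ/4`. -/
noncomputable def iPow (a : ZMod 4) : ℂ := Complex.I ^ a.val

theorem iPow_zero : iPow 0 = 1 := by simp [iPow]

theorem iPow_add (a b : ZMod 4) : iPow (a + b) = iPow a * iPow b := by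
  rw [iPow, iPow, iPow, ← pow_add, ZMod.val_add, ← Complex.I_pow_eq_pow_mod]

theorem iPow_sum {ι : Type*} (s : Finset ι) (f : ι → ZMod 4) :
    iPow (∑ i ∈ s, f i) = ∏ i ∈ s, iPow (f i) := by
  classical
  induction s using Finset.induction_on with
  | empty => simp [iPow_zero]
  | insert a s ha ih => rw [Finset.sum_insert ha, Finset.prod_insert ha, iPow_add, ih]

theorem norm_iPow (a : ZMod 4) : ‖iPow a‖ = 1 := by simp [iPow]

theorem conj_iPow (a : ZMod 4) : (starRingEnd ℂ) (iPow a) = iPow (-a) := by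
  have h : iPow a * iPow (-a) = 1 := by rw [← iPow_add, add_neg_cancel, iPow_zero]
  have h2 : iPow a * (starRingEnd ℂ) (iPow a) = 1 := by
    rw [Complex.mul_conj, Complex.normSq_eq_norm_sq, norm_iPow]; simp
  have h0 : iPow a ≠ 0 := fun h0 => by simp [h0] at h
  exact mul_left_cancel₀ h0 (h2.trans h.symm)

/-- The sign `(-1) ^ a` of a bit. -/
noncomputable def sgn (a : ZMod 2) : ℂ := iPow (2 * liftBit a)

theorem liftBit_zero : liftBit 0 = 0 := by decide
theorem liftBit_one : liftBit 1 = 1 := by decide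
theorem iPow_two_mul_liftBit (a : ZMod 2) : iPow (2 * liftBit a) = sgn a := rfl
theorem sgn_zero : sgn 0 = 1 := by simp [sgn, liftBit_zero, iPow_zero]

theorem sgn_one : sgn 1 = -1 := by
  have : (2 * liftBit 1).val = 2 := by decide
  rw [sgn, iPow, this, Complex.I_sq]

/-- Lifting a sum of bits costs a carry `2ab`, which doubling kills in ℤ/4. -/
theorem two_mul_liftBit_add : ∀ a b : ZMod 2,
    2 * liftBit (a + b) = 2 * liftBit a + 2 * liftBit b := by decide

theorem liftBit_mul : ∀ a b : ZMod 2, liftBit (a * b) = liftBit a * liftBit b := by decide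

theorem liftBit_add : ∀ a b : ZMod 2,
    liftBit (a + b) = liftBit a + liftBit b - 2 * liftBit a * liftBit b := by decide

theorem liftBit_add_one : ∀ a : ZMod 2, liftBit (a + 1) = 1 - liftBit a := by decide

theorem liftBit_injective : Function.Injective liftBit := by
  intro a b; revert a b; decide

theorem bit_cases : ∀ a : ZMod 2, a = 0 ∨ a = 1 := by decide

theorem sum_bit {M : Type*} [AddCommMonoid M] (f : ZMod 2 → M) : ∑ a, f a = f 0 + f 1 :=
  Fin.sum_univ_two f

/-! ### Gates acting on path sums -/

/-- The state vector `ψ` is, up to a global phase, the path sum of the polynomial built so far. -/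
def IsPathSum {m : ℕ} (s : BuildState m) (ψ : (Fin m → ZMod 2) → ℂ) : Prop :=
  ∃ (ann : (Fin s.count → ZMod 2) → Fin m → ZMod 2) (q : (Fin s.count → ZMod 2) → ZMod 4),
    (∀ (f : Fin s.count → ZMod 2) (σ : PVar m → ZMod 4), (∀ i, σ (.x i) = 0) →
      (∀ k : Fin s.count, σ (.y k) = liftBit (f k)) →
      (∀ i, MvPolynomial.eval σ (s.ann i) = liftBit (ann f i)) ∧
        MvPolynomial.eval σ s.poly = q f) ∧
    ∃ c : ℂ, ‖c‖ = 1 ∧ ∀ r,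
      ψ r = c * ((Real.sqrt 2 : ℂ) ^ s.count)⁻¹ * ∑ f, if ann f = r then iPow (q f) else 0

theorem mulVec_pathSum {m N : ℕ} (U : Matrix (Fin m → ZMod 2) (Fin m → ZMod 2) ℂ)
    {ψ : (Fin m → ZMod 2) → ℂ} {ann : (Fin N → ZMod 2) → Fin m → ZMod 2}
    {p : (Fin N → ZMod 2) → ℂ} {c : ℂ}
    (hψ : ∀ r, ψ r = c * ∑ f, if ann f = r then p f else 0) (r : Fin m → ZMod 2) :
    U.mulVec ψ r = c * ∑ f, U r (ann f) * p f := by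
  simp only [Matrix.mulVec, dotProduct, hψ, Finset.mul_sum]
  rw [Finset.sum_comm]
  refine Finset.sum_congr rfl fun f _ => ?_
  rw [Finset.sum_eq_single (ann f)]
  · simp; ring
  · intro x _ hx; simp [Ne.symm hx]
  · simp

/-- A gate that permutes the basis states up to powers of `i` and a global phase. -/
theorem IsPathSum.permute {m : ℕ} {s s' : BuildState m} {ψ : (Fin m → ZMod 2) → ℂ}
    (h : IsPathSum s ψ) (U : Matrix (Fin m → ZMod 2) (Fin m → ZMod 2) ℂ)
    (π : (Fin m → ZMod 2) → Fin m → ZMod 2) (δ : (Fin m → ZMod 2) → ZMod 4) (d : ℂ)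
    (hd : ‖d‖ = 1) (hU : ∀ r c, U r c = if π c = r then d * iPow (δ c) else 0)
    (hcount : s'.count = s.count)
    (hstep : ∀ (σ : PVar m → ZMod 4) (u : Fin m → ZMod 2),
      (∀ i, MvPolynomial.eval σ (s.ann i) = liftBit (u i)) →
      (∀ i, MvPolynomial.eval σ (s'.ann i) = liftBit (π u i)) ∧
        MvPolynomial.eval σ s'.poly = MvPolynomial.eval σ s.poly + δ u) :
    IsPathSum s' (U.mulVec ψ) := by
  obtain ⟨N, a', p'⟩ := s'
  dsimp only at hcount hstep
  subst hcount
  obtain ⟨ann, q, hev, c, hc, hψ⟩ := h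
  refine ⟨fun f => π (ann f), fun f => q f + δ (ann f), ?_, c * d, by simp [hc, hd], ?_⟩
  · intro f σ hx hy
    obtain ⟨h1, h2⟩ := hev f σ hx hy
    obtain ⟨h3, h4⟩ := hstep σ (ann f) h1
    exact ⟨h3, by rw [h4, h2]⟩
  · intro r
    rw [mulVec_pathSum U hψ]
    simp only [hU, Finset.mul_sum]
    refine Finset.sum_congr rfl fun f _ => ?_
    split_ifs
    · rw [iPow_add]; ring
    · simp

/-- The new last variable is the new bit of line `i`, so the sum over `count + 1` bits splits into
the old paths and this bit. -/
theorem IsPathSum.hadamard {m : ℕ} {s : BuildState m} {ψ : (Fin m → ZMod 2) → ℂ}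
    (h : IsPathSum s ψ) (i : Fin m) :
    IsPathSum (s.step (.H i)) ((Gate.H i).unitary.mulVec ψ) := by
  obtain ⟨ann, q, hev, c, hc, hψ⟩ := h
  refine ⟨fun f => Function.update (ann (Fin.init f)) i (f (Fin.last s.count)),
    fun f => q (Fin.init f) + 2 * liftBit (ann (Fin.init f) i * f (Fin.last s.count)), ?_,
    c, hc, ?_⟩
  · intro f σ hx hy
    obtain ⟨h1, h2⟩ := hev (Fin.init f) σ hx (fun k => by simpa [Fin.init] using hy k.castSucc)
    have hl : σ (.y s.count) = liftBit (f (Fin.last s.count)) := by simpa using hy (Fin.last _)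
    refine ⟨fun l => ?_, ?_⟩
    · by_cases hl' : l = i
      · subst hl'; simp [BuildState.step, hl]
      · simp [BuildState.step, hl', h1]
    · simp [BuildState.step, h1, h2, hl, liftBit_mul, mul_assoc]
  · intro r
    change _ = c * ((Real.sqrt 2 : ℂ) ^ (s.count + 1))⁻¹ * ∑ f : Fin (s.count + 1) → ZMod 2,
      if Function.update (ann (Fin.init f)) i (f (Fin.last s.count)) = r then
        iPow (q (Fin.init f) + 2 * liftBit (ann (Fin.init f) i * f (Fin.last s.count))) else 0
    rw [mulVec_pathSum _ hψ, ← (Fin.snocEquiv fun _ : Fin (s.count + 1) => ZMod 2).sum_comp,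
      Fintype.sum_prod_type_right]
    have hH : ∀ u : Fin m → ZMod 2, (Gate.H i).unitary r u = (Real.sqrt 2 : ℂ)⁻¹ *
        ∑ a : ZMod 2, if Function.update u i a = r then sgn (u i * a) else 0 := by
      intro u
      -- Only the value `a = r i` of the new bit can lead to the output `r`.
      rw [Finset.sum_eq_single (r i)]
      · by_cases hr : ∀ l, l ≠ i → r l = u l
        · rw [if_pos]
          · simp only [Gate.unitary, onLine, Matrix.of_apply, if_pos hr]
            rcases bit_cases (r i) with h1 | h1 <;> rcases bit_cases (u i) with h2 | h2 <;>
              simp [h1, h2, sgn_one, sgn_zero, div_eq_mul_inv]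
          · ext l
            by_cases hl : l = i
            · subst hl; simp
            · simp [hl, hr l hl]
        · rw [if_neg]
          · simp only [Gate.unitary, onLine, Matrix.of_apply, if_neg hr, mul_zero]
          · intro hu
            exact hr fun l hl => by simpa [hl] using (congrFun hu l).symm
      · intro a _ ha
        rw [if_neg]
        rintro rfl
        simp at ha
      · simp
    rw [pow_succ, mul_inv, ← mul_assoc, mul_assoc (c * _), Finset.mul_sum (a := (_ : ℂ)⁻¹)]
    congr 1
    refine Finset.sum_congr rfl fun f _ => ?_
    rw [hH, mul_assoc, Finset.sum_mul]
    congr 1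
    refine Finset.sum_congr rfl fun a _ => ?_
    simp only [Fin.snocEquiv, Equiv.coe_fn_mk, Fin.init_snoc, Fin.snoc_last]
    split_ifs
    · rw [iPow_add, sgn, mul_comm]
    · simp

theorem IsPathSum.step {m : ℕ} {s : BuildState m} {ψ : (Fin m → ZMod 2) → ℂ}
    (h : IsPathSum s ψ) (g : Gate m) : IsPathSum (s.step g) (g.unitary.mulVec ψ) := by
  have key : ∀ (i : Fin m) (r c : Fin m → ZMod 2) (a : ZMod 2),
      Function.update c i a = r ↔ (∀ l, l ≠ i → r l = c l) ∧ r i = a := by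
    intro i r c a
    constructor
    · rintro rfl; exact ⟨fun l hl => by simp [hl], by simp⟩
    · rintro ⟨h1, h2⟩; ext l
      by_cases hl : l = i
      · subst hl; simp [h2]
      · simp [hl, h1 l hl]
  have keyid : ∀ (i : Fin m) (r c : Fin m → ZMod 2),
      c = r ↔ (∀ l, l ≠ i → r l = c l) ∧ r i = c i := by
    intro i r c
    rw [← key, Function.update_eq_self]
  cases g with
  | H i => exact h.hadamard i
  | S i =>
    refine h.permute _ id (fun u => liftBit (u i)) 1 (by simp) ?_ rfl ?_
    · intro r c
      simp only [id, keyid i r c, Gate.unitary, onLine, Matrix.of_apply, ite_and]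
      rcases bit_cases (c i) with h1 | h1 <;> simp [h1, iPow, liftBit_zero, liftBit_one,
        ZMod.val_one'']
    · intro σ u hu
      exact ⟨hu, by simp [BuildState.step, hu]⟩
  | Z i =>
    refine h.permute _ id (fun u => 2 * liftBit (u i)) 1 (by simp) ?_ rfl ?_
    · intro r c
      simp only [id, keyid i r c, Gate.unitary, onLine, Matrix.of_apply, ite_and]
      rcases bit_cases (c i) with h1 | h1 <;> simp [h1, iPow_two_mul_liftBit, sgn_zero, sgn_one]
    · intro σ u hu
      exact ⟨hu, by simp [BuildState.step, hu]⟩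
  | X i =>
    refine h.permute _ (fun u => Function.update u i (u i + 1)) (fun _ => 0) 1 (by simp) ?_ rfl ?_
    · intro r c
      simp only [key i r c, Gate.unitary, onLine, Matrix.of_apply, ite_and]
      simp [iPow_zero]
    · intro σ u hu
      refine ⟨fun l => ?_, by simp [BuildState.step]⟩
      by_cases hl : l = i
      · subst hl; simp [BuildState.step, hu, liftBit_add_one]
      · simp [BuildState.step, hl, hu]
  | Y i =>
    -- `Y = i X Z`: the scalar `i` goes into the global phase, the sign of `Z` into the polynomial.
    refine h.permute _ (fun u => Function.update u i (u i + 1)) (fun u => 2 * liftBit (u i))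
      Complex.I (by simp) ?_ rfl ?_
    · intro r c
      simp only [key i r c, Gate.unitary, onLine, Matrix.of_apply, ite_and, iPow_two_mul_liftBit]
      rcases bit_cases (c i) with h1 | h1 <;> simp [h1, sgn_zero, sgn_one]
    · intro σ u hu
      refine ⟨fun l => ?_, by simp [BuildState.step, hu]⟩
      by_cases hl : l = i
      · subst hl; simp [BuildState.step, hu, liftBit_add_one]
      · simp [BuildState.step, hl, hu]
  | CZ i j hij =>
    refine h.permute _ id (fun u => 2 * liftBit (u i * u j)) 1 (by simp) ?_ rfl ?_
    · intro r c
      have : c = r ↔ (∀ l, l ≠ i → l ≠ j → r l = c l) ∧ (r i, r j) = (c i, c j) := by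
        constructor
        · rintro rfl; simp
        · rintro ⟨h1, h2⟩; ext l
          rw [Prod.mk.injEq] at h2
          by_cases hi : l = i
          · rw [hi, h2.1]
          by_cases hj : l = j
          · rw [hj, h2.2]
          exact (h1 l hi hj).symm
      simp only [id, this, Gate.unitary, onLines, Matrix.of_apply, ite_and, iPow_two_mul_liftBit]
      rcases bit_cases (c i) with h1 | h1 <;> rcases bit_cases (c j) with h2 | h2 <;>
        simp [h1, h2, sgn_zero, sgn_one]
    · intro σ u hu
      exact ⟨hu, by simp [BuildState.step, hu, liftBit_mul, mul_assoc]⟩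
  | CNOT i j hij =>
    refine h.permute _ (fun u => Function.update u j (u i + u j)) (fun _ => 0) 1 (by simp) ?_ rfl ?_
    · intro r c
      have : Function.update c j (c i + c j) = r ↔
          (∀ l, l ≠ i → l ≠ j → r l = c l) ∧ (r i, r j) = (c i, c i + c j) := by
        rw [key, Prod.mk.injEq]
        constructor
        · rintro ⟨h1, h2⟩; exact ⟨fun l _ hl => h1 l hl, h1 i hij, h2⟩
        · rintro ⟨h1, h2, h3⟩
          refine ⟨fun l hl => ?_, h3⟩
          by_cases hi : l = i
          · rw [hi, h2]
          exact h1 l hi hl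
      simp only [this, Gate.unitary, onLines, Matrix.of_apply, ite_and]
      simp [iPow_zero]
    · intro σ u hu
      refine ⟨fun l => ?_, by simp [BuildState.step]⟩
      by_cases hl : l = j
      · subst hl; simp [BuildState.step, hu, liftBit_add]
      · simp [BuildState.step, hl, hu]

theorem Circuit.unitary_append {m : ℕ} (C D : Circuit m) :
    Circuit.unitary (C ++ D) = Circuit.unitary D * Circuit.unitary C := by
  induction C with
  | nil => simp [Circuit.unitary]
  | cons g C ih =>
    rw [List.cons_append, Circuit.unitary, ih, Circuit.unitary, Matrix.mul_assoc]

theorem isPathSum_build {m : ℕ} (C : Circuit m) :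
    IsPathSum (build C) (fun r => amplitude C r 0) := by
  induction C using List.reverseRecOn with
  | nil =>
    refine ⟨fun _ _ => 0, fun _ => 0, ?_, 1, by simp, ?_⟩
    · intro f σ hx _
      exact ⟨fun i => by simp [build, hx, liftBit_zero], by simp [build]⟩
    · intro r
      change amplitude [] r 0 = 1 * ((Real.sqrt 2 : ℂ) ^ 0)⁻¹ *
        ∑ f : Fin 0 → ZMod 2, if (fun _ => 0) = r then iPow 0 else 0
      simp only [amplitude, Circuit.unitary, Matrix.one_apply, iPow_zero, pow_zero, inv_one,
        one_mul, Fintype.sum_unique]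
      exact if_congr ⟨fun h => h.symm, fun h => h.symm⟩ rfl rfl
  | append_singleton C g ih =>
    have h1 : build (C ++ [g]) = (build C).step g := by simp [build]
    have h2 : (fun r => amplitude (C ++ [g]) r 0) =
        g.unitary.mulVec (fun r => amplitude C r 0) := by
      ext r
      rw [amplitude, Circuit.unitary_append]
      simp [Circuit.unitary, Matrix.mul_apply, Matrix.mulVec, dotProduct, amplitude]
    rw [h1, h2]
    exact ih.step g

/-! ### The amplitude as a normalized exponential sum of `q_C` -/

theorem sum_sgn_mul (a : ZMod 2) : ∑ w : ZMod 2, sgn (w * a) = if a = 0 then 2 else 0 := by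
  rcases bit_cases a with rfl | rfl <;> simp [sum_bit, sgn_zero, sgn_one]

theorem sum_prod_apply {ι κ : Type*} [Fintype ι] [DecidableEq ι] [Fintype κ]
    (F : ι → κ → ℂ) : ∑ y : ι → κ, ∏ i, F i (y i) = ∏ i, ∑ a, F i a := by
  rw [Finset.prod_univ_sum, Fintype.piFinset_univ]

/-- After doubling only residues modulo 2 matter, so the output term becomes the sign `(-1)^(w (u +
z))`. -/
theorem two_mul_liftBit_mul_sub : ∀ w a b : ZMod 2,
    2 * liftBit w * (liftBit a - liftBit b) = 2 * liftBit (w * (a + b)) := by decide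

/-- The Hadamard variables, given the output and the variables that are not identified with it. -/
noncomputable def OutputChoice.extend {m : ℕ} {C : Circuit m} (o : OutputChoice C)
    (b : Fin m → ZMod 2) (v : {k : Fin (build C).count // ∀ j, o.var j ≠ some k} → ZMod 2)
    (k : Fin (build C).count) : ZMod 2 :=
  open Classical in
  if h : ∃ j, o.var j = some k then b h.choose else v ⟨k, fun j hj => h ⟨j, hj⟩⟩

theorem OutputChoice.extend_of_eq_some {m : ℕ} {C : Circuit m} (o : OutputChoice C)
    (b : Fin m → ZMod 2) (v : {k : Fin (build C).count // ∀ j, o.var j ≠ some k} → ZMod 2)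
    {j : Fin m} {k : Fin (build C).count} (h : o.var j = some k) : o.extend b v k = b j := by
  have hex : ∃ j, o.var j = some k := ⟨j, h⟩
  rw [extend, dif_pos hex, o.inj _ _ _ hex.choose_spec h]

theorem OutputChoice.extend_coe {m : ℕ} {C : Circuit m} (o : OutputChoice C)
    (b : Fin m → ZMod 2) (v : {k : Fin (build C).count // ∀ j, o.var j ≠ some k} → ZMod 2)
    (k : {k : Fin (build C).count // ∀ j, o.var j ≠ some k}) : o.extend b v k = v k := by
  rw [extend, dif_neg fun ⟨j, hj⟩ => k.2 j hj]

/-- The amplitude is, up to a global phase, the normalized exponential sum of `q_C`. -/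
theorem OutputChoice.amplitude_eq {m : ℕ} {C : Circuit m} (o : OutputChoice C)
    (b : Fin m → ZMod 2) : ∃ c : ℂ, ‖c‖ = 1 ∧
      amplitude C b 0 = c * ((Real.sqrt 2 : ℂ) ^ o.normExp)⁻¹ *
        ∑ v : o.FreeVar → ZMod 2, iPow (o.value v b) := by
  classical
  obtain ⟨ann, q, hev, c, hc, hψ⟩ := isPathSum_build C
  refine ⟨c, hc, ?_⟩
  have hval : ∀ v : o.FreeVar → ZMod 2, o.value v b =
      q (o.extend b (v ∘ Sum.inl)) + ∑ j : {j : Fin m // o.var j = none},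
        2 * liftBit (v (Sum.inr j) * (ann (o.extend b (v ∘ Sum.inl)) j + b j)) := by
    intro v
    obtain ⟨h1, h2⟩ := hev (o.extend b (v ∘ Sum.inl)) (o.assign v b) (fun _ => rfl) (by
      intro k
      simp only [assign, extend, Fin.is_lt, dif_pos, Fin.eta, Function.comp]
      split_ifs <;> rfl)
    rw [value, poly, map_add, h2, map_sum]
    congr 1
    refine Finset.sum_congr rfl fun j _ => ?_
    have hw : o.assign v b (.w j) = liftBit (v (Sum.inr j)) := by simp [assign, j.2]
    have hz : o.assign v b (.z j) = liftBit (b j) := rfl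
    simp only [map_mul, map_sub, MvPolynomial.eval_X, h1, hw, hz, map_ofNat,
      two_mul_liftBit_mul_sub]
  have hann : ∀ f j k, o.var j = some k → ann f j = f k := by
    intro f j k hjk
    apply liftBit_injective
    -- Any assignment compatible with `f` will do; the variables other than the `y_k` are set to
    -- zero.
    obtain ⟨h1, -⟩ := hev f (fun
      | .y l => if h : l < (build C).count then liftBit (f ⟨l, h⟩) else 0
      | _ => 0) (fun _ => rfl) (fun k => by simp)
    rw [← h1 j, o.valid j k hjk]
    simp
  -- Lines identified with an output variable end in the right bit automatically, so only the lines
  -- with a `w_j` impose a condition.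
  have hiff : ∀ v, (∀ j : {j : Fin m // o.var j = none}, ann (o.extend b v) j + b j = 0) ↔
      ann (o.extend b v) = b := by
    intro v
    simp only [CharTwo.add_eq_zero]
    refine ⟨fun h => funext fun j => ?_, fun h j => congrFun h j⟩
    cases hj : o.var j with
    | none => exact h ⟨j, hj⟩
    | some k => rw [hann _ j k hj, o.extend_of_eq_some b v hj]
  -- The `w_j` sums give the indicator of the output `b` and one factor 2 each. The sum over the
  -- free `y_k` may then be extended to all Hadamard bits.
  have hsum : ∑ v : o.FreeVar → ZMod 2, iPow (o.value v b) =
      2 ^ Fintype.card {j : Fin m // o.var j = none} *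
        ∑ f, if ann f = b then iPow (q f) else 0 := by
    rw [← (Equiv.sumArrowEquivProdArrow _ _ (ZMod 2)).symm.sum_comp, Fintype.sum_prod_type,
      ← Fintype.sum_of_injective (o.extend b) ?_
        (fun v => if ann (o.extend b v) = b then iPow (q (o.extend b v)) else 0) _ ?_
        (fun _ => rfl),
      Finset.mul_sum]
    · refine Finset.sum_congr rfl fun v _ => ?_
      have : ∀ w : {j : Fin m // o.var j = none} → ZMod 2,
          iPow (o.value ((Equiv.sumArrowEquivProdArrow _ _ (ZMod 2)).symm (v, w)) b) =
          iPow (q (o.extend b v)) * ∏ j, sgn (w j * (ann (o.extend b v) j + b j)) := by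
        intro w
        rw [hval, iPow_add, iPow_sum]
        rfl
      simp only [this]
      rw [← Finset.mul_sum, sum_prod_apply
        (fun (j : {j : Fin m // o.var j = none}) a => sgn (a * (ann (o.extend b v) j + b j)))]
      simp only [sum_sgn_mul, Fintype.prod_ite_zero, hiff, Finset.prod_const]
      split_ifs
      · rw [mul_comm]; rfl
      · simp
    · intro v v' h
      ext k
      rw [← o.extend_coe b v, h, o.extend_coe]
    · intro f hf
      rw [if_neg]
      rintro rfl
      -- A path ending in `b` has the bit `b j` at each identified variable, hence lies in the range
      -- of `extend`.
      refine hf ⟨fun k => f k, funext fun k => ?_⟩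
      by_cases h : ∃ j, o.var j = some k
      · obtain ⟨j, hj⟩ := h
        rw [o.extend_of_eq_some _ _ hj, hann _ _ _ hj]
      · exact o.extend_coe _ _ ⟨k, fun j hj => h ⟨j, hj⟩⟩
  rw [show amplitude C b 0 = _ from hψ b, hsum, normExp, pow_add, pow_mul]
  -- The factor `2^t` cancels half of the `√2 ^ (2t)` from the `2^t` of the `w_j` sums and leaves
  -- `√2 ^ h`.
  have h2 : (Real.sqrt 2 : ℂ) ^ 2 = 2 := by
    rw [← Complex.ofReal_pow, Real.sq_sqrt (by norm_num)]; norm_num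
  rw [h2, mul_inv, mul_assoc c, mul_assoc c, mul_assoc (_ ^ _)⁻¹ (_ ^ _)⁻¹,
    inv_mul_cancel_left₀ (pow_ne_zero _ two_ne_zero)]

theorem OutputChoice.norm_amplitude_sq {m : ℕ} {C : Circuit m} (o : OutputChoice C)
    (b : Fin m → ZMod 2) : ‖amplitude C b 0‖ ^ 2 =
      ‖∑ v : o.FreeVar → ZMod 2, iPow (o.value v b)‖ ^ 2 / 2 ^ o.normExp := by
  obtain ⟨c, hc, h⟩ := o.amplitude_eq b
  rw [h, norm_mul, norm_mul, hc, one_mul, norm_inv, norm_pow, mul_pow, inv_pow, pow_right_comm]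
  have : ‖(Real.sqrt 2 : ℂ)‖ ^ 2 = 2 := by
    rw [Complex.norm_real, Real.norm_eq_abs, sq_abs, Real.sq_sqrt (by norm_num)]
  rw [this, mul_comm, div_eq_mul_inv]

/-- Identified lines and identified variables correspond bijectively, so `h - (m - t)` Hadamard
variables and `t` variables `w_j` remain. This later bounds the exponent of `R²` by `2n`. -/
theorem OutputChoice.card_freeVar_add {m : ℕ} {C : Circuit m} (o : OutputChoice C) :
    Fintype.card o.FreeVar + m = o.normExp := by
  classical
  have h1 := Fintype.card_subtype_compl (fun j : Fin m => o.var j = none)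
  have h2 := Fintype.card_subtype_compl (fun k : Fin (build C).count => ∃ j, o.var j = some k)
  have h3 := Fintype.card_subtype_le (fun j : Fin m => o.var j = none)
  have h4 := Fintype.card_subtype_le (fun k : Fin (build C).count => ∃ j, o.var j = some k)
  have h5 : Fintype.card {j : Fin m // ¬ o.var j = none} =
      Fintype.card {k : Fin (build C).count // ∃ j, o.var j = some k} := by
    have hs : ∀ j : {j : Fin m // ¬ o.var j = none}, ∃ k, o.var j = some k :=
      fun j => Option.ne_none_iff_exists'.1 j.2
    choose e he using hs
    refine Fintype.card_of_bijective (f := fun j => ⟨e j, j, he j⟩) ⟨?_, ?_⟩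
    · intro j j' h
      rw [Subtype.mk.injEq] at h
      exact Subtype.ext (o.inj _ _ _ (he j) (h ▸ he j'))
    · rintro ⟨k, j, hj⟩
      refine ⟨⟨j, by simp [hj]⟩, Subtype.ext (Option.some_injective _ ?_)⟩
      exact (he _).symm.trans hj
  have h6 : Fintype.card {k : Fin (build C).count // ∀ j, o.var j ≠ some k} =
      Fintype.card {k : Fin (build C).count // ¬ ∃ j, o.var j = some k} :=
    Fintype.card_congr (Equiv.subtypeEquivRight fun k => by simp)
  rw [Fintype.card_fin] at *
  rw [normExp, Fintype.card_sum]
  omega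

/-! ### Unitarity -/

/-- Only the intermediate states that agree with `r` off line `i` contribute; they are parametrized
by their bit on that line. -/
theorem onLine_mul {m : ℕ} (i : Fin m) (M N : ZMod 2 → ZMod 2 → ℂ) :
    onLine i M * onLine i N = onLine i fun r c => ∑ a, M r a * N a c := by
  ext r c
  simp only [Matrix.mul_apply, onLine, Matrix.of_apply]
  rw [← Fintype.sum_of_injective (fun a => Function.update r i a) ?_
    (fun a => if ∀ l, l ≠ i → r l = c l then M (r i) a * N a (c i) else 0) _ ?_ ?_]
  · split_ifs <;> simp
  · exact Function.update_injective r i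
  · intro x hx
    rw [if_neg, zero_mul]
    intro h
    refine hx ⟨x i, funext fun l => ?_⟩
    by_cases hl : l = i
    · subst hl; simp
    · simp [hl, h l hl]
  · intro a
    have hp : ∀ l, l ≠ i → r l = Function.update r i a l := fun l hl => by simp [hl]
    have : (∀ l, l ≠ i → Function.update r i a l = c l) ↔ ∀ l, l ≠ i → r l = c l :=
      forall_congr' fun l => forall_congr' fun hl => by simp [hl]
    simp only [this, if_pos hp, Function.update_self]
    split_ifs <;> simp

theorem onLines_mul {m : ℕ} {i j : Fin m} (hij : i ≠ j)
    (M N : ZMod 2 × ZMod 2 → ZMod 2 × ZMod 2 → ℂ) :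
    onLines i j M * onLines i j N = onLines i j fun r c => ∑ a, M r a * N a c := by
  ext r c
  simp only [Matrix.mul_apply, onLines, Matrix.of_apply]
  rw [← Fintype.sum_of_injective
    (fun a : ZMod 2 × ZMod 2 => Function.update (Function.update r i a.1) j a.2) ?_
    (fun a => if ∀ l, l ≠ i → l ≠ j → r l = c l then M (r i, r j) a * N a (c i, c j) else 0) _ ?_ ?_]
  · split_ifs <;> simp
  · intro a a' h
    have h1 := congrFun h i
    have h2 := congrFun h j
    simp [hij] at h1 h2
    exact Prod.ext h1 h2
  · intro x hx
    rw [if_neg, zero_mul]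
    intro h
    refine hx ⟨(x i, x j), funext fun l => ?_⟩
    by_cases hj : l = j
    · subst hj; simp
    by_cases hi : l = i
    · subst hi; simp [hij]
    · simp [hi, hj, h l hi hj]
  · intro a
    have hp : ∀ l, l ≠ i → l ≠ j →
        r l = Function.update (Function.update r i a.1) j a.2 l := fun l hi hj => by simp [hi, hj]
    have : (∀ l, l ≠ i → l ≠ j → Function.update (Function.update r i a.1) j a.2 l = c l) ↔
        ∀ l, l ≠ i → l ≠ j → r l = c l :=
      forall_congr' fun l => forall_congr' fun hi => forall_congr' fun hj => by simp [hi, hj]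
    simp only [this, if_pos hp, Function.update_self, Function.update_of_ne hij]
    split_ifs <;> simp

theorem onLine_mem_unitary {m : ℕ} (i : Fin m) (M : ZMod 2 → ZMod 2 → ℂ)
    (hM : ∀ r c, ∑ a, M r a * (starRingEnd ℂ) (M c a) = if r = c then 1 else 0) :
    onLine i M ∈ Matrix.unitaryGroup (Fin m → ZMod 2) ℂ := by
  rw [Matrix.mem_unitaryGroup_iff]
  have hs : star (onLine i M) = onLine i fun r c => (starRingEnd ℂ) (M c r) := by
    ext r c
    simp only [Matrix.star_apply, onLine, Matrix.of_apply, apply_ite star, star_zero, eq_comm]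
    rfl
  rw [hs, onLine_mul]
  ext r c
  simp only [onLine, Matrix.of_apply, hM, Matrix.one_apply, ← ite_and]
  refine if_congr ⟨fun ⟨h1, h2⟩ => funext fun l => ?_, fun h => by simp [h]⟩ rfl rfl
  by_cases hl : l = i
  · rw [hl, h2]
  · exact h1 l hl

theorem onLines_mem_unitary {m : ℕ} {i j : Fin m} (hij : i ≠ j)
    (M : ZMod 2 × ZMod 2 → ZMod 2 × ZMod 2 → ℂ)
    (hM : ∀ r c, ∑ a, M r a * (starRingEnd ℂ) (M c a) = if r = c then 1 else 0) :
    onLines i j M ∈ Matrix.unitaryGroup (Fin m → ZMod 2) ℂ := by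
  rw [Matrix.mem_unitaryGroup_iff]
  have hs : star (onLines i j M) = onLines i j fun r c => (starRingEnd ℂ) (M c r) := by
    ext r c
    simp only [Matrix.star_apply, onLines, Matrix.of_apply, apply_ite star, star_zero, eq_comm]
    rfl
  rw [hs, onLines_mul hij]
  ext r c
  simp only [onLines, Matrix.of_apply, hM, Matrix.one_apply, ← ite_and]
  refine if_congr ⟨fun ⟨h1, h2⟩ => funext fun l => ?_, fun h => by simp [h]⟩ rfl rfl
  rw [Prod.mk.injEq] at h2
  by_cases hi : l = i
  · rw [hi, h2.1]
  by_cases hj : l = j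
  · rw [hj, h2.2]
  · exact h1 l hi hj

theorem Gate.unitary_mem {m : ℕ} (g : Gate m) :
    g.unitary ∈ Matrix.unitaryGroup (Fin m → ZMod 2) ℂ := by
  have h10 : (1 : ZMod 2) + 1 = 0 := by decide
  have h2 : ((Real.sqrt 2 : ℂ))⁻¹ * (Real.sqrt 2 : ℂ)⁻¹ = 2⁻¹ := by
    rw [← mul_inv, ← Complex.ofReal_mul, Real.mul_self_sqrt (by norm_num)]; norm_num
  cases g with
  | H i =>
    refine onLine_mem_unitary i _ fun r c => ?_
    rcases bit_cases r with rfl | rfl <;> rcases bit_cases c with rfl | rfl <;>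
      simp [sum_bit, div_eq_mul_inv, h2]
    all_goals norm_num
  | S i | X i | Y i | Z i =>
    refine onLine_mem_unitary i _ fun r c => ?_
    rcases bit_cases r with rfl | rfl <;> rcases bit_cases c with rfl | rfl <;>
      simp [sum_bit, h10]
  | CZ i j hij | CNOT i j hij =>
    refine onLines_mem_unitary hij _ fun r c => ?_
    obtain ⟨r, r'⟩ := r
    obtain ⟨c, c'⟩ := c
    rcases bit_cases r with rfl | rfl <;> rcases bit_cases c with rfl | rfl <;>
      rcases bit_cases r' with rfl | rfl <;> rcases bit_cases c' with rfl | rfl <;>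
      simp [Fintype.sum_prod_type, sum_bit, h10]

theorem Circuit.unitary_mem {m : ℕ} (C : Circuit m) :
    Circuit.unitary C ∈ Matrix.unitaryGroup (Fin m → ZMod 2) ℂ := by
  induction C with
  | nil => exact one_mem _
  | cons g C ih => exact mul_mem ih g.unitary_mem

/-- Used to see that the exponent in the output is not negative. -/
theorem norm_amplitude_le_one {m : ℕ} (C : Circuit m) (b a : Fin m → ZMod 2) :
    ‖amplitude C b a‖ ≤ 1 :=
  entry_norm_bound_of_unitary (Circuit.unitary_mem C) b a

/-! ### Sums of signs over bit vectors -/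

theorem sgn_sum {ι : Type*} (s : Finset ι) (f : ι → ZMod 2) :
    sgn (∑ i ∈ s, f i) = ∏ i ∈ s, sgn (f i) := by
  classical
  induction s using Finset.induction_on with
  | empty => simp [sgn_zero]
  | insert a s ha ih =>
    rw [Finset.sum_insert ha, Finset.prod_insert ha, ← ih, sgn, two_mul_liftBit_add, iPow_add, sgn,
      sgn]

theorem two_mul_liftBit_sum {ι : Type*} (s : Finset ι) (f : ι → ZMod 2) :
    2 * liftBit (∑ i ∈ s, f i) = ∑ i ∈ s, 2 * liftBit (f i) := by
  classical
  induction s using Finset.induction_on with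
  | empty => simp [liftBit_zero]
  | insert a s ha ih => rw [Finset.sum_insert ha, Finset.sum_insert ha, ← ih, two_mul_liftBit_add]

/-- A sum of signs over the bit vectors supported on `p`. -/
theorem sum_sgn_dotProduct {ι : Type*} [Fintype ι] [DecidableEq ι] (p : ι → Prop) [DecidablePred p]
    (w : ι → ZMod 2) :
    (∑ z : ι → ZMod 2, if ∀ k, p k ∨ z k = 0 then sgn (∑ k, w k * z k) else 0) =
      if ∃ k, p k ∧ w k = 1 then 0 else 2 ^ Fintype.card {k // p k} := by
  have h1 : ∀ z : ι → ZMod 2, (if ∀ k, p k ∨ z k = 0 then sgn (∑ k, w k * z k) else 0) =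
      ∏ k, if p k ∨ z k = 0 then sgn (w k * z k) else 0 := by
    intro z
    rw [sgn_sum, Fintype.prod_ite_zero]
  simp only [h1]
  rw [sum_prod_apply fun k a => if p k ∨ a = 0 then sgn (w k * a) else 0]
  -- The sum factors over coordinates: 1 off `p`, and `1 + (-1)^(w k)` on `p`.
  have h2 : ∀ k, (∑ a : ZMod 2, if p k ∨ a = 0 then sgn (w k * a) else 0) =
      if p k then (if w k = 1 then 0 else 2) else 1 := by
    intro k
    rcases bit_cases (w k) with h | h <;> by_cases hp : p k <;>
      simp [sum_bit, hp, h, sgn_zero, sgn_one]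
  simp only [h2]
  split_ifs with h
  · obtain ⟨k, hk, hw⟩ := h
    exact Finset.prod_eq_zero (Finset.mem_univ k) (by simp [hk, hw])
  · have : ∀ k, (if p k then (if w k = 1 then (0 : ℂ) else 2) else 1) = if p k then 2 else 1 := by
      intro k
      by_cases hp : p k
      · simpa [hp] using fun hw => h ⟨k, hp, hw⟩
      · simp [hp]
    simp only [this, Finset.prod_ite, Finset.prod_const, one_pow, mul_one, Fintype.card_subtype]

theorem sum_sgn_dotProduct_eq {ι : Type*} [Fintype ι] [DecidableEq ι] (v : ι → ZMod 2) :
    ∑ y : ι → ZMod 2, sgn (y ⬝ᵥ v) = if v = 0 then 2 ^ Fintype.card ι else 0 := by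
  have h := sum_sgn_dotProduct (fun _ : ι => True) v
  simp only [true_or, implies_true, if_true, true_and] at h
  have h' : ∀ y : ι → ZMod 2, y ⬝ᵥ v = ∑ k, v k * y k := fun y =>
    Finset.sum_congr rfl fun k _ => mul_comm _ _
  simp only [h', h, Fintype.card_subtype_true]
  have : (∃ k, v k = 1) ↔ ¬ v = 0 := by
    rw [funext_iff, not_forall]
    refine exists_congr fun k => ?_
    rcases bit_cases (v k) with h | h <;> simp [h]
  simp only [this, ite_not]

/-! ### Quadratic forms over ℤ/4 evaluated at bit vectors -/

section QuadraticForms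

variable {n : ℕ}

theorem dotProduct_mulVec_add {A : Matrix (Fin n) (Fin n) (ZMod 4)} (hA : A.IsSymm)
    (u v : Fin n → ZMod 4) :
    (u + v) ⬝ᵥ A.mulVec (u + v) = u ⬝ᵥ A.mulVec u + v ⬝ᵥ A.mulVec v + 2 * (u ⬝ᵥ A.mulVec v) := by
  have : v ⬝ᵥ A.mulVec u = u ⬝ᵥ A.mulVec v := by
    rw [Matrix.dotProduct_mulVec, ← Matrix.mulVec_transpose, hA.eq, dotProduct_comm]
  rw [Matrix.mulVec_add, add_dotProduct, dotProduct_add, dotProduct_add, this]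
  ring

/-- If `u = v + 2e`, symmetry doubles the cross term, so both correction terms are multiples of 4.
This is what makes a change of variables over 𝔽₂ legitimate. -/
theorem dotProduct_mulVec_congr {A : Matrix (Fin n) (Fin n) (ZMod 4)} (hA : A.IsSymm)
    {u v : Fin n → ZMod 4} (h : ∀ i, 2 * u i = 2 * v i) :
    u ⬝ᵥ A.mulVec u = v ⬝ᵥ A.mulVec v := by
  have key : ∀ a b : ZMod 4, 2 * a = 2 * b → ∃ e, a = b + 2 * e := by decide
  choose e he using fun i => key _ _ (h i)
  have hu : u = v + (2 : ZMod 4) • e := funext fun i => by simp [he i]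
  have h4 : (2 : ZMod 4) * 2 = 0 := by decide
  rw [hu, dotProduct_mulVec_add hA, Matrix.mulVec_smul, dotProduct_smul, smul_dotProduct,
    dotProduct_smul]
  simp only [smul_eq_mul, ← mul_assoc, h4]
  ring

/-- The lift of `Q y` and the product of the lifts differ only by multiples of 2, which the form
does not see. -/
theorem quadForm_mulVec {A : Matrix (Fin n) (Fin n) (ZMod 4)} (hA : A.IsSymm)
    (Q : Matrix (Fin n) (Fin n) (ZMod 2)) (y : Fin n → ZMod 2) :
    quadForm A (Q.mulVec y) = quadForm ((Q.map liftBit).transpose * A * Q.map liftBit) y := by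
  have h : quadForm ((Q.map liftBit).transpose * A * Q.map liftBit) y =
      ((Q.map liftBit).mulVec fun i => liftBit (y i)) ⬝ᵥ
        A.mulVec ((Q.map liftBit).mulVec fun i => liftBit (y i)) := by
    rw [quadForm, ← Matrix.mulVec_mulVec, ← Matrix.mulVec_mulVec, Matrix.dotProduct_mulVec,
      ← Matrix.mulVec_transpose, Matrix.transpose_transpose]
  rw [h]
  refine dotProduct_mulVec_congr hA fun i => ?_
  simp only [Matrix.mulVec, dotProduct, two_mul_liftBit_sum, liftBit_mul, Matrix.map_apply,
    Finset.mul_sum]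

theorem quadForm_add {D : Matrix (Fin n) (Fin n) (ZMod 2)} (hD : D.IsSymm) (y z : Fin n → ZMod 2) :
    quadForm (D.map liftBit) (y + z) = quadForm (D.map liftBit) y + quadForm (D.map liftBit) z +
      2 * liftBit (y ⬝ᵥ D.mulVec z) := by
  have hA : (D.map liftBit).IsSymm := hD.map liftBit
  have h : 2 * liftBit (y ⬝ᵥ D.mulVec z) =
      2 * ((fun i => liftBit (y i)) ⬝ᵥ (D.map liftBit).mulVec fun i => liftBit (z i)) := by
    simp only [Matrix.mulVec, dotProduct, Finset.mul_sum, two_mul_liftBit_sum, liftBit_mul,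
      Matrix.map_apply]
  rw [h]
  exact (dotProduct_mulVec_congr (u := fun i => liftBit (y i + z i))
    (v := (fun i => liftBit (y i)) + fun i => liftBit (z i)) hA fun i => by
      rw [two_mul_liftBit_add, Pi.add_apply, mul_add]).trans (dotProduct_mulVec_add hA _ _)

/-- Bits are idempotent, so a doubled diagonal form is linear. -/
theorem quadForm_add_two_smul_diag {B : Matrix (Fin n) (Fin n) (ZMod 4)}
    {D : Matrix (Fin n) (Fin n) (ZMod 2)} (hD : D.IsDiag) (y : Fin n → ZMod 2) :
    quadForm (B + 2 • D.map liftBit) y = quadForm B y + 2 * liftBit (∑ k, D k k * y k) := by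
  rw [quadForm, Matrix.add_mulVec, dotProduct_add, ← quadForm, two_mul_liftBit_sum]
  congr 1
  simp only [dotProduct, Matrix.mulVec, Matrix.smul_apply, Matrix.map_apply]
  refine Finset.sum_congr rfl fun k _ => ?_
  rw [Finset.sum_eq_single k]
  · generalize D k k = a
    generalize y k = b
    revert a b
    decide
  · intro l _ hl
    rw [hD hl.symm, liftBit_zero, smul_zero, zero_mul]
  · simp

/-! ### Normal forms as partial involutions: square, rank, kernel -/

/-- The shape shared by the two normal forms: `D` is the adjacency matrix of a partial involution
that moves no index by more than one. -/
def IsInvolutive (D : Matrix (Fin n) (Fin n) (ZMod 2)) : Prop :=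
  ∃ (π : Fin n → Fin n) (p : Fin n → Prop), (∀ k, π (π k) = k) ∧ (∀ k, p (π k) ↔ p k) ∧
    (∀ k, (π k : ℕ) ≤ k + 1 ∧ (k : ℕ) ≤ π k + 1) ∧ ∀ k l, D k l = 1 ↔ p k ∧ l = π k

theorem IsInvolutive.isSymm {D : Matrix (Fin n) (Fin n) (ZMod 2)} (h : IsInvolutive D) :
    D.IsSymm := by
  obtain ⟨π, p, hπ, hp, -, hD⟩ := h
  have key : ∀ a b : ZMod 2, (a = 1 ↔ b = 1) → a = b := by decide
  refine Matrix.IsSymm.ext fun i j => key _ _ ?_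
  rw [hD, hD]
  constructor
  · rintro ⟨h, rfl⟩; exact ⟨(hp _).2 h, (hπ j).symm⟩
  · rintro ⟨h, rfl⟩; exact ⟨(hp _).2 h, (hπ i).symm⟩

/-- Row `k` of `D` vanishes. -/
def IsZeroRow (D : Matrix (Fin n) (Fin n) (ZMod 2)) (k : Fin n) : Prop := ∀ l, D k l = 0

noncomputable instance (D : Matrix (Fin n) (Fin n) (ZMod 2)) : DecidablePred (IsZeroRow D) :=
  Classical.decPred _

theorem IsInvolutive.row_eq_zero_iff {D : Matrix (Fin n) (Fin n) (ZMod 2)} {π : Fin n → Fin n}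
    {p : Fin n → Prop} (hD : ∀ k l, D k l = 1 ↔ p k ∧ l = π k) (k : Fin n) :
    IsZeroRow D k ↔ ¬ p k := by
  rw [IsZeroRow]
  have key : ∀ a : ZMod 2, a = 0 ↔ a ≠ 1 := by decide
  simp only [key, Ne, hD]
  exact ⟨fun h hk => h _ ⟨hk, rfl⟩, fun h l hl => h hl.1⟩

/-- Following the involution twice returns to the start, and is possible exactly from the nonzero
rows. -/
theorem IsInvolutive.mul_self {D : Matrix (Fin n) (Fin n) (ZMod 2)} (h : IsInvolutive D) :
    D * D = Matrix.diagonal fun k => if IsZeroRow D k then 0 else 1 := by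
  classical
  obtain ⟨π, p, hπ, hp, -, hD⟩ := h
  have key : ∀ a : ZMod 2, a = if a = 1 then 1 else 0 := by decide
  ext k l
  simp only [Matrix.mul_apply, IsInvolutive.row_eq_zero_iff hD, Matrix.diagonal_apply]
  rw [Finset.sum_eq_single (π k)]
  · rw [key (D k (π k)), key (D (π k) l)]
    simp only [hD, hp, hπ]
    by_cases h1 : p k <;> by_cases h2 : k = l <;> simp [h1, h2, eq_comm]
  · intro x _ hx
    rw [key (D k x), if_neg fun h => hx ((hD k x).1 h).2, zero_mul]
  · simp

theorem isInvolutive_of_isDiag {D : Matrix (Fin n) (Fin n) (ZMod 2)} (h : D.IsDiag) :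
    IsInvolutive D := by
  refine ⟨id, fun k => D k k = 1, fun _ => rfl, fun _ => Iff.rfl, fun k => by simp, fun k l => ?_⟩
  by_cases hkl : l = k
  · simp [hkl]
  · simp [hkl, h (Ne.symm hkl)]

/-- The involution swaps `2j` and `2j + 1` below `2g` and fixes all other indices. -/
theorem isInvolutive_blockMatrix {g : ℕ} (hg : 2 * g ≤ n) : IsInvolutive (blockMatrix n g) := by
  refine ⟨fun k : Fin n => if h : (k : ℕ) < 2 * g then
      (if h2 : (k : ℕ) % 2 = 0 then ⟨(k : ℕ) + 1, by omega⟩ else ⟨(k : ℕ) - 1, by omega⟩) else k,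
    fun k => (k : ℕ) < 2 * g, fun k => ?_, fun k => ?_, fun k => ?_, fun k l => ?_⟩
  · by_cases h : (k : ℕ) < 2 * g <;> by_cases h2 : (k : ℕ) % 2 = 0
    · have h3 : (k : ℕ) + 1 < 2 * g := by omega
      have h4 : ((k : ℕ) + 1) % 2 ≠ 0 := by omega
      simp [h, h2, h3, h4]
    · have h3 : (k : ℕ) - 1 < 2 * g := by omega
      have h4 : ((k : ℕ) - 1) % 2 = 0 := by omega
      have h5 : (k : ℕ) - 1 + 1 = k := by omega
      simp only [h, h2, h3, h4, h5, dite_true, dite_false]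
    · simp [h]
    · simp [h]
  · dsimp only; split_ifs <;> simp <;> omega
  · dsimp only; split_ifs <;> simp <;> omega
  · simp only [blockMatrix, Matrix.of_apply]
    have : ∀ q : Prop, ∀ _ : Decidable q, (if q then (1 : ZMod 2) else 0) = 1 ↔ q := by
      intro q _; split_ifs with h <;> simp [h]
    rw [this]
    constructor
    · rintro ⟨j, hj, h⟩
      refine ⟨by omega, Fin.ext ?_⟩
      rw [dif_pos (by omega)]
      split_ifs <;> simp <;> omega
    · rintro ⟨h, h2⟩
      rw [dif_pos h, Fin.ext_iff] at h2
      refine ⟨k / 2, by omega, ?_⟩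
      split_ifs at h2 <;> simp at h2 <;> omega

theorem IsNormalForm.isInvolutive {A : Matrix (Fin n) (Fin n) (ZMod 4)}
    {Q D₁ D₂ : Matrix (Fin n) (Fin n) (ZMod 2)} (h : IsNormalForm A Q D₁ D₂) :
    IsInvolutive D₁ := by
  obtain ⟨-, -, -, h1, h2⟩ := h
  by_cases hA : IsAlternating A
  · obtain ⟨g, hg, rfl⟩ := h1 hA
    exact isInvolutive_blockMatrix hg
  · exact isInvolutive_of_isDiag (h2 hA)

/-- Since `D = D² D`, the matrices `D` and `D²` have equal rank, and `D²` is a diagonal projection.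
-/
theorem rank_eq_card {D : Matrix (Fin n) (Fin n) (ZMod 2)}
    (hDD : D * D = Matrix.diagonal fun k => if IsZeroRow D k then 0 else 1) :
    D.rank = Fintype.card {k // ¬ IsZeroRow D k} := by
  have hr := Matrix.rank_diagonal fun k : Fin n => if IsZeroRow D k then (0 : ZMod 2) else 1
  have hc : Fintype.card {k : Fin n // (if IsZeroRow D k then (0 : ZMod 2) else 1) ≠ 0} =
      Fintype.card {k // ¬ IsZeroRow D k} :=
    Fintype.card_congr (Equiv.subtypeEquivRight fun k => by split_ifs with h <;> simp [h])
  rw [← hc, ← hr]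
  refine le_antisymm ?_ ?_
  · have : D = Matrix.diagonal (fun k => if IsZeroRow D k then (0 : ZMod 2) else 1) * D := by
      ext k l
      rw [Matrix.diagonal_mul]
      split_ifs with h
      · rw [h, mul_zero]
      · rw [one_mul]
    exact (congrArg Matrix.rank this).le.trans (Matrix.rank_mul_le_left _ _)
  · rw [← hDD]
    exact Matrix.rank_mul_le_left _ _

theorem mulVec_eq_zero_iff {D : Matrix (Fin n) (Fin n) (ZMod 2)} (hD : D.IsSymm)
    (hDD : D * D = Matrix.diagonal fun k => if IsZeroRow D k then 0 else 1) (z : Fin n → ZMod 2) :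
    D.mulVec z = 0 ↔ ∀ k, IsZeroRow D k ∨ z k = 0 := by
  constructor
  · intro h k
    have h1 : (D * D).mulVec z k = 0 := by rw [← Matrix.mulVec_mulVec, h]; simp
    rw [hDD, Matrix.mulVec_diagonal] at h1
    split_ifs at h1 with h2
    · exact Or.inl h2
    · exact Or.inr (by simpa using h1)
  · intro h
    ext k
    rw [Matrix.mulVec, dotProduct, Pi.zero_apply]
    refine Finset.sum_eq_zero fun l _ => ?_
    rcases h l with h | h
    -- By symmetry a zero row is also a zero column.
    · rw [← hD.apply k l, h, zero_mul]
    · rw [h, mul_zero]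

open Classical in
/-- The exponential sum of a quadratic form in normal form, with linear part `w`. -/
theorem norm_sum_sq {D : Matrix (Fin n) (Fin n) (ZMod 2)} (hD : D.IsSymm)
    (hDD : D * D = Matrix.diagonal fun k => if IsZeroRow D k then 0 else 1) (w : Fin n → ZMod 2) :
    ‖∑ y : Fin n → ZMod 2,
        iPow (quadForm (D.map liftBit) y + 2 * liftBit (∑ k, w k * y k))‖ ^ 2 =
      if ∃ k, IsZeroRow D k ∧ w k = 1 then (0 : ℝ) else 2 ^ (2 * n - D.rank) := by
  set q : (Fin n → ZMod 2) → ZMod 4 :=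
    fun y => quadForm (D.map liftBit) y + 2 * liftBit (∑ k, w k * y k) with hq
  have hadd : ∀ y z, q (y + z) = q y + q z + 2 * liftBit (y ⬝ᵥ D.mulVec z) := by
    intro y z
    simp only [hq, quadForm_add hD, Pi.add_apply, mul_add, Finset.sum_add_distrib,
      two_mul_liftBit_add]
    ring
  -- A kernel vector is supported on zero rows, so the quadratic part vanishes there and `q` is
  -- linear.
  have hker : ∀ z, D.mulVec z = 0 → iPow (q z) = sgn (∑ k, w k * z k) := by
    intro z hz
    have h0 : quadForm (D.map liftBit) z = 0 := by
      rw [quadForm, dotProduct]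
      refine Finset.sum_eq_zero fun k _ => ?_
      rcases (mulVec_eq_zero_iff hD hDD z).1 hz k with h | h
      · rw [Matrix.mulVec, dotProduct, Finset.sum_eq_zero, mul_zero]
        intro l _
        rw [Matrix.map_apply, h, liftBit_zero, zero_mul]
      · rw [h, liftBit_zero, zero_mul]
    rw [hq, sgn]
    simp only [h0, zero_add]
  have hcomplex : (∑ y, iPow (q y)) * (starRingEnd ℂ) (∑ y, iPow (q y)) =
      2 ^ n * ∑ z : Fin n → ZMod 2,
        if ∀ k, IsZeroRow D k ∨ z k = 0 then sgn (∑ k, w k * z k) else 0 := by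
    rw [map_sum, Finset.sum_mul_sum, Finset.sum_comm, Finset.mul_sum]
    have h1 : ∀ y, ∑ x, iPow (q x) * (starRingEnd ℂ) (iPow (q y)) =
        ∑ z, iPow (q z) * sgn (y ⬝ᵥ D.mulVec z) := by
      intro y
      -- With `x = y + z`, the terms `q y` cancel against the conjugate, and `y` survives only in
      -- the polar form.
      rw [← Equiv.sum_comp (Equiv.addLeft y)]
      refine Finset.sum_congr rfl fun z _ => ?_
      rw [Equiv.coe_addLeft, conj_iPow, ← iPow_add, sgn, ← iPow_add, hadd]
      congr 1
      ring
    simp only [h1]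
    rw [Finset.sum_comm]
    refine Finset.sum_congr rfl fun z _ => ?_
    rw [← Finset.mul_sum, sum_sgn_dotProduct_eq, Fintype.card_fin]
    simp only [← mulVec_eq_zero_iff hD hDD]
    split_ifs with h
    · rw [hker z h, mul_comm]
    · simp
  -- One factor `2^n` comes from the sum over `y`, the other `2^(n-r)` from the kernel.
  have hcard : n + Fintype.card {k : Fin n // IsZeroRow D k} = 2 * n - D.rank := by
    have h1 := Fintype.card_subtype_compl fun k : Fin n => IsZeroRow D k
    have h2 := Fintype.card_subtype_le fun k : Fin n => IsZeroRow D k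
    rw [Fintype.card_fin] at h1 h2
    rw [rank_eq_card hDD]
    omega
  have hsum : (∑ z : Fin n → ZMod 2,
      if ∀ k, IsZeroRow D k ∨ z k = 0 then sgn (∑ k, w k * z k) else 0) =
      if ∃ k, IsZeroRow D k ∧ w k = 1 then 0 else 2 ^ Fintype.card {k // IsZeroRow D k} := by
    convert sum_sgn_dotProduct (IsZeroRow D) w
  rw [hsum, Complex.mul_conj, Complex.normSq_eq_norm_sq] at hcomplex
  rw [← hcard, pow_add]
  split_ifs at hcomplex ⊢
  · exact_mod_cast hcomplex.trans (mul_zero _)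
  · exact_mod_cast hcomplex

end QuadraticForms

/-! ### The formula for the squared amplitude -/

open Classical in
theorem norm_amplitude_sq_eq {m n : ℕ} {C : Circuit m} {o : OutputChoice C} {ord : Fin n ≃ o.FreeVar}
    {A : Matrix (Fin n) (Fin n) (ZMod 4)} {pos : Fin m → Fin n}
    {Q D₁ D₂ : Matrix (Fin n) (Fin n) (ZMod 2)} (hA : o.IsPresentedBy ord A pos)
    (hN : IsNormalForm A Q D₁ D₂) (b : Fin m → ZMod 2) :
    ‖amplitude C b 0‖ ^ 2 =
      (if ∃ k, IsZeroRow D₁ k ∧ linearPart Q D₂ pos b k = 1 then 0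
        else 2 ^ (2 * n - D₁.rank)) / 2 ^ o.normExp := by
  rw [o.norm_amplitude_sq, ← norm_sum_sq hN.isInvolutive.isSymm hN.isInvolutive.mul_self]
  obtain ⟨hsymm, -, c, hc⟩ := hA
  obtain ⟨hQ, hform, hdiag, -, -⟩ := hN
  have hinj : Function.Bijective Q.mulVec :=
    ⟨Matrix.mulVec_injective_iff_isUnit.2 ((Matrix.isUnit_iff_isUnit_det Q).2 hQ),
      Matrix.mulVec_surjective_iff_isUnit.2 ((Matrix.isUnit_iff_isUnit_det Q).2 hQ)⟩
  have key : ∑ v : o.FreeVar → ZMod 2, iPow (o.value v b) =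
      (∑ y : Fin n → ZMod 2, iPow (quadForm (D₁.map liftBit) y +
        2 * liftBit (∑ k, linearPart Q D₂ pos b k * y k))) * iPow (c b) := by
    rw [← (ord.arrowCongr (Equiv.refl (ZMod 2))).sum_comp, ← hinj.sum_comp, Finset.sum_mul]
    refine Finset.sum_congr rfl fun y _ => ?_
    have h1 := hc b (Q.mulVec y)
    rw [quadForm_mulVec hsymm, hform, quadForm_add_two_smul_diag hdiag] at h1
    rw [← iPow_add]
    refine congrArg iPow (h1.trans ?_)
    rw [add_assoc (quadForm _ _)]
    congr 2
    -- The output term becomes linear with row `pos j` of `Q`: `∑ b_j (Q y)_(pos j) = ∑_k (∑_j b_j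
    -- Q_(pos j, k)) y_k`.
    simp only [linearPart, ← liftBit_mul, Finset.mul_sum]
    rw [← two_mul_liftBit_sum, ← two_mul_liftBit_add]
    congr 2
    simp only [add_mul, Finset.sum_add_distrib, Matrix.mulVec, dotProduct, Finset.sum_mul,
      Finset.mul_sum]
    rw [Finset.sum_comm (γ := Fin n)]
    simp only [mul_assoc]
  rw [key, norm_mul, norm_iPow, mul_one]

theorem two_mul_sub_rank_le {m n : ℕ} {C : Circuit m} {o : OutputChoice C} {ord : Fin n ≃ o.FreeVar}
    {A : Matrix (Fin n) (Fin n) (ZMod 4)} {pos : Fin m → Fin n}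
    {Q D₁ D₂ : Matrix (Fin n) (Fin n) (ZMod 2)} (hA : o.IsPresentedBy ord A pos)
    (hN : IsNormalForm A Q D₁ D₂) (b : Fin m → ZMod 2)
    (hb : ¬ ∃ k, IsZeroRow D₁ k ∧ linearPart Q D₂ pos b k = 1) :
    2 * n - D₁.rank ≤ o.normExp := by
  have h := norm_amplitude_sq_eq hA hN b
  rw [if_neg hb] at h
  have h1 : ‖amplitude C b 0‖ ^ 2 ≤ 1 := pow_le_one₀ (norm_nonneg _) (norm_amplitude_le_one C b 0)
  rw [h, div_le_one (by positivity)] at h1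
  exact (pow_le_pow_iff_right₀ (by norm_num)).1 h1

/-! ### Reasoning about running time on the word RAM -/

/-- Program `p` halts from `s` within `T` steps, in a state satisfying `Φ`. -/
def Runs (W : ℕ) (p : Prog) (s : RAMState) (T : ℕ) (Φ : RAMState → Prop) : Prop :=
  ∃ t s', Exec W p s t s' ∧ t ≤ T ∧ Φ s'

theorem Runs.seq {W : ℕ} {p q : Prog} {s : RAMState} {T₁ T₂ T : ℕ} {Φ Ψ : RAMState → Prop}
    (hp : Runs W p s T₁ Φ) (hq : ∀ s', Φ s' → Runs W q s' T₂ Ψ) (hT : T₁ + T₂ ≤ T) :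
    Runs W (.seq p q) s T Ψ := by
  obtain ⟨t₁, s₁, h₁, ht₁, hΦ⟩ := hp
  obtain ⟨t₂, s₂, h₂, ht₂, hΨ⟩ := hq s₁ hΦ
  exact ⟨_, _, .seq h₁ h₂, by omega, hΨ⟩

theorem Runs.cond {W r : ℕ} {p q : Prog} {s : RAMState} {T : ℕ} {Φ : RAMState → Prop}
    (hp : s.reg r ≠ 0 → Runs W p s T Φ) (hq : s.reg r = 0 → Runs W q s T Φ) :
    Runs W (.cond r p q) s (T + 1) Φ := by
  by_cases h : s.reg r = 0
  · obtain ⟨t, s', h1, h2, h3⟩ := hq h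
    exact ⟨_, _, .cond_false h h1, by omega, h3⟩
  · obtain ⟨t, s', h1, h2, h3⟩ := hp h
    exact ⟨_, _, .cond_true h h1, by omega, h3⟩

/-- The invariant is indexed by the number of completed rounds. Each round pays one step for its
test, and the final failing test pays one more. -/
theorem Runs.loop {W r N : ℕ} {p : Prog} {I : ℕ → RAMState → Prop} {T : ℕ → ℕ}
    (hstep : ∀ i < N, ∀ s, I i s → s.reg r ≠ 0 ∧ Runs W p s (T i) (I (i + 1)))
    (hend : ∀ s, I N s → s.reg r = 0) {s : RAMState} (h0 : I 0 s) :
    Runs W (.loop r p) s (∑ i ∈ Finset.range N, (T i + 1) + 1) (I N) := by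
  induction N generalizing I T s with
  | zero => exact ⟨_, _, .loop_done (hend s h0), by simp, h0⟩
  | succ N ih =>
    obtain ⟨hr, t₁, s₁, h1, ht1, hI1⟩ := hstep 0 (by omega) s h0
    -- The induction removes the first round, so the invariant and the costs are shifted by one.
    obtain ⟨t₂, s₂, h2, ht2, hI2⟩ := ih (I := fun i => I (i + 1)) (T := fun i => T (i + 1))
      (fun i hi => hstep (i + 1) (by omega)) hend hI1
    refine ⟨_, _, .loop_step hr h1 h2, ?_, hI2⟩
    rw [Finset.sum_range_succ']
    omega

/-! ### The program

Array `5` accumulates the linear part `w`; register `3` holds the constant `1`. -/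

/-- `w := diag D₂`. -/
def initLinear : Prog :=
  .seq (.const 3 1) <| .seq (.copy 4 0) <| .seq (.const 5 0) <| .seq (.const 6 0) <|
  .loop 4 <|
    .seq (.load 7 2 6) <| .seq (.store 5 5 7) <| .seq (.add 5 5 3) <| .seq (.add 6 6 0) <|
    .seq (.add 6 6 3) <| .sub 4 4 3

/-- Add the row of `Q` that starts at the address in register `6` to `w`. -/
def addRow : Prog :=
  .loop 8 <|
    .seq (.load 10 0 6) <|
    -- Adding a one modulo 2 replaces the bit `v` by `1 - v`.
    .seq (.cond 10 (.seq (.load 11 5 9) <| .seq (.sub 11 3 11) <| .store 5 9 11) .skip) <|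
    .seq (.add 6 6 3) <| .seq (.add 9 9 3) <| .sub 8 8 3

/-- Add the row of `Q` of index `pos j` to `w`, where register `5` holds `j`. -/
def addRowAt : Prog :=
  .seq (.seq (.load 8 4 5) (.const 6 0)) <|
  -- The address `pos j * n` by repeated addition, at most `n` rounds.
  .seq (.loop 8 (.seq (.add 6 6 0) (.sub 8 8 3))) <|
  .seq (.seq (.copy 8 0) (.const 9 0)) addRow

/-- Add to `w` the rows of `Q` selected by the output vector. -/
def addRows : Prog :=
  .seq (.seq (.copy 4 1) (.const 5 0)) <|
  .loop 4 <|
    .seq (.load 7 3 5) <| .seq (.cond 7 addRowAt .skip) <| .seq (.add 5 5 3) (.sub 4 4 3)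

/-- Count the nonzero rows of `D₁` in register `13`, and set register `12` to one if `w` is one at
a zero row. -/
def scanRows : Prog :=
  .seq (.seq (.const 12 0) <| .seq (.const 13 0) <| .seq (.copy 4 0) <| .seq (.const 5 0)
    (.const 6 0)) <|
  .loop 4 <|
    -- From the diagonal address `k * (n + 1)`, adding 1 gives entry `(k, k+1)` and subtracting `n`
    -- gives `(k-1, k)`, which by symmetry is `(k, k-1)`.
    .seq (.seq (.load 7 1 6) <| .seq (.add 8 6 3) <| .seq (.load 8 1 8) <| .seq (.add 7 7 8) <|
      .seq (.sub 8 6 0) <| .seq (.load 8 1 8) <| .add 7 7 8) <|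
    .seq (.cond 7 (.add 13 13 3) (.seq (.load 8 5 5) (.cond 8 (.const 12 1) .skip))) <|
    .seq (.add 5 5 3) <| .seq (.add 6 6 0) <| .seq (.add 6 6 3) <| .sub 4 4 3

/-- Write the result. -/
def writeResult : Prog :=
  .seq (.add 1 2 13) <| .seq (.sub 1 1 0) <| .seq (.sub 1 1 0) (.sub 0 3 12)

/-- The program computing the squared modulus of an amplitude. -/
def amplitudeProg : Prog :=
  .seq initLinear <| .seq addRows <| .seq scanRows writeResult

/-! ### Correctness and cost of the program on raw arrays -/

section Correctness

/-- The registers and arrays that are not changed before the result is written. -/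
structure Frame (n m ρ : ℕ) (q d₁ d₂ b pos : ℕ → ℕ) (s : RAMState) : Prop where
  reg0 : s.reg 0 = n
  reg1 : s.reg 1 = m
  reg2 : s.reg 2 = ρ
  reg3 : s.reg 3 = 1
  arr0 : s.arr 0 = q
  arr1 : s.arr 1 = d₁
  arr2 : s.arr 2 = d₂
  arr3 : s.arr 3 = b
  arr4 : s.arr 4 = pos

variable {W n m ρ : ℕ} {q d₁ d₂ b pos : ℕ → ℕ}

theorem Frame.setReg {s : RAMState} (h : Frame n m ρ q d₁ d₂ b pos s) {d : ℕ} (hd : 4 ≤ d) (v : ℕ) :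
    Frame n m ρ q d₁ d₂ b pos (s.setReg d v) := by
  have hne : ∀ i, i < 4 → i ≠ d := fun i hi => by omega
  obtain ⟨h0, h1, h2, h3, h4, h5, h6, h7, h8⟩ := h
  constructor <;> simp [RAMState.setReg, *]

theorem Frame.setArr {s : RAMState} (h : Frame n m ρ q d₁ d₂ b pos s) (i v : ℕ) :
    Frame n m ρ q d₁ d₂ b pos (s.setArr 5 i v) := by
  obtain ⟨h0, h1, h2, h3, h4, h5, h6, h7, h8⟩ := h
  constructor <;> simp [RAMState.setArr, *]

theorem runs_initLinear (hW : 10 * (n + 1) ^ 2 ≤ W) {s : RAMState} (h0 : s.reg 0 = n)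
    (h1 : s.reg 1 = m) (h2 : s.reg 2 = ρ) (a0 : s.arr 0 = q) (a1 : s.arr 1 = d₁)
    (a2 : s.arr 2 = d₂) (a3 : s.arr 3 = b) (a4 : s.arr 4 = pos) :
    Runs W initLinear s (7 * n + 5) fun s' => Frame n m ρ q d₁ d₂ b pos s' ∧
      ∀ k < n, s'.arr 5 k = d₂ (k * (n + 1)) := by
  -- The word bound in expanded form, with `n * n` as an atom for `omega`; it shows that no address
  -- wraps around.
  have hW' : 10 * (n * n) + 20 * n + 10 ≤ W := by nlinarith
  have hW1 : 1 % W = 1 := Nat.mod_eq_of_lt (by omega)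
  let I : ℕ → RAMState → Prop := fun i s => Frame n m ρ q d₁ d₂ b pos s ∧ s.reg 4 = n - i ∧
    s.reg 5 = i ∧ s.reg 6 = i * (n + 1) ∧ ∀ k < i, s.arr 5 k = d₂ (k * (n + 1))
  have hloop : ∀ s, I 0 s → _ := fun s hs => Runs.loop (W := W) (r := 4) (N := n) (I := I)
    (T := fun _ => 6) (p := .seq (.load 7 2 6) <| .seq (.store 5 5 7) <| .seq (.add 5 5 3) <|
      .seq (.add 6 6 0) <| .seq (.add 6 6 3) <| .sub 4 4 3) (by
      rintro i hi s ⟨hF, h4, h5, h6, hacc⟩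
      refine ⟨by omega, _, _, by repeat' constructor, by norm_num, ?_⟩
      have hin : i * n ≤ n * n := Nat.mul_le_mul_right n hi.le
      have e1 : (i + 1) % W = i + 1 := Nat.mod_eq_of_lt (by omega)
      have e2 : (i * (n + 1) + n) % W = i * (n + 1) + n := Nat.mod_eq_of_lt (by
        rw [mul_add]; omega)
      have e3 : (i * (n + 1) + n + 1) % W = i * (n + 1) + n + 1 := Nat.mod_eq_of_lt (by
        rw [mul_add]; omega)
      refine ⟨?_, ?_, ?_, ?_, ?_⟩
      · repeat' first | exact hF | refine Frame.setReg ?_ (by norm_num) _ | refine Frame.setArr ?_ _ _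
      · simp [RAMState.setReg, RAMState.setArr, h4, hF.reg3]; omega
      · simp [RAMState.setReg, RAMState.setArr, h5, hF.reg3, e1]
      · simp [RAMState.setReg, RAMState.setArr, h6, hF.reg3, hF.reg0, e2, e3]; ring
      · intro k hk
        by_cases hki : k = i
        · subst hki
          simp [RAMState.setReg, RAMState.setArr, h6, h5, hF.arr2]
        · have := hacc k (by omega)
          simp [RAMState.setReg, RAMState.setArr, h6, h5, this, hki])
    (by rintro s ⟨-, h4, -⟩; omega) hs
  refine Runs.seq (T₁ := 1) (Φ := fun s' => s' = s.setReg 3 1) ⟨_, _, .const _ _ _, le_rfl,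
    by rw [hW1]⟩ ?_ (T₂ := 7 * n + 4) (by omega)
  rintro _ rfl
  refine Runs.seq (T₁ := 1) (Φ := fun s' => s' = (s.setReg 3 1).setReg 4 n) ⟨_, _, .copy _ _ _,
    le_rfl, by simp [RAMState.setReg, h0]⟩ ?_ (T₂ := 7 * n + 3) (by omega)
  rintro _ rfl
  refine Runs.seq (T₁ := 1) (Φ := fun s' => s' = ((s.setReg 3 1).setReg 4 n).setReg 5 0)
    ⟨_, _, .const _ _ _, le_rfl, by simp⟩ ?_ (T₂ := 7 * n + 2) (by omega)
  rintro _ rfl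
  refine Runs.seq (T₁ := 1) (Φ := I 0)
    ⟨_, _, .const _ _ _, le_rfl, ?_⟩ (fun s' hs' => ?_) (T₂ := 7 * n + 1) (by omega)
  · refine ⟨?_, ?_, ?_, ?_, ?_⟩
    · constructor <;> simp [RAMState.setReg, *]
    all_goals simp [RAMState.setReg]
  · obtain ⟨t, s'', h, ht, hI⟩ := hloop s' hs'
    refine ⟨t, s'', h, ?_, hI.1, hI.2.2.2.2⟩
    simp at ht; omega

theorem runs_addRow (hW : 10 * (n + 1) ^ 2 ≤ W) (F : ℕ → ℕ) {i : ℕ} (hi : i ≤ n) {s : RAMState}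
    (hF : Frame n m ρ q d₁ d₂ b pos s) (h8 : s.reg 8 = n) (h9 : s.reg 9 = 0)
    (h6 : s.reg 6 = i * n) (hacc : ∀ k < n, s.arr 5 k = F k) :
    Runs W addRow s (9 * n + 1) fun s' => Frame n m ρ q d₁ d₂ b pos s' ∧ s'.reg 4 = s.reg 4 ∧
      s'.reg 5 = s.reg 5 ∧ ∀ k < n, s'.arr 5 k = if q (i * n + k) = 0 then F k else 1 - F k := by
  have hW' : 10 * (n * n) + 20 * n + 10 ≤ W := by nlinarith
  have hin : i * n ≤ n * n := Nat.mul_le_mul_right n hi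
  let I : ℕ → RAMState → Prop := fun l s' => Frame n m ρ q d₁ d₂ b pos s' ∧ s'.reg 4 = s.reg 4 ∧
    s'.reg 5 = s.reg 5 ∧ s'.reg 8 = n - l ∧ s'.reg 9 = l ∧ s'.reg 6 = i * n + l ∧
    -- Only the entries before the current column `l` have been updated.
    ∀ k < n, s'.arr 5 k = if q (i * n + k) = 0 ∨ l ≤ k then F k else 1 - F k
  obtain ⟨t, s', h, ht, hI⟩ := Runs.loop (W := W) (r := 8) (N := n) (I := I)
    (T := fun _ => 8) (s := s) (p := .seq (.load 10 0 6) <|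
      .seq (.cond 10 (.seq (.load 11 5 9) <| .seq (.sub 11 3 11) <| .store 5 9 11) .skip) <|
      .seq (.add 6 6 3) <| .seq (.add 9 9 3) <| .sub 8 8 3) (by
    rintro l hl s' ⟨hF, h4, h5, h8, h9, h6, hacc⟩
    have e1 : (l + 1) % W = l + 1 := Nat.mod_eq_of_lt (by omega)
    have e2 : (i * n + l + 1) % W = i * n + l + 1 := Nat.mod_eq_of_lt (by omega)
    have hl5 := hacc l hl
    simp only [le_refl, or_true, if_true] at hl5
    refine ⟨by omega, ?_⟩
    by_cases hq : q (i * n + l) = 0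
    · refine ⟨_, _, .seq (.load _ _ _ _) (.seq (.cond_false ?_ (.skip _)) (.seq (.add _ _ _ _)
        (.seq (.add _ _ _ _) (.sub _ _ _ _)))), by norm_num, ?_, ?_, ?_, ?_, ?_, ?_, ?_⟩
      · simp [RAMState.setReg, h6, hF.arr0, hq]
      · repeat' first | exact hF | refine Frame.setReg ?_ (by norm_num) _
      · simp [RAMState.setReg, h4]
      · simp [RAMState.setReg, h5]
      · simp [RAMState.setReg, h8, hF.reg3]; omega
      · simp [RAMState.setReg, h9, hF.reg3, e1]
      · simp [RAMState.setReg, h6, hF.reg3, e2]; omega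
      · intro k hk
        have := hacc k hk
        by_cases hkl : k = l
        · subst hkl
          simpa [RAMState.setReg, hq] using hl5
        · have hle : l + 1 ≤ k ↔ l ≤ k := by omega
          simp [RAMState.setReg, this, hle]
    · refine ⟨_, _, .seq (.load _ _ _ _) (.seq (.cond_true ?_ (.seq (.load _ _ _ _)
        (.seq (.sub _ _ _ _) (.store _ _ _ _)))) (.seq (.add _ _ _ _)
        (.seq (.add _ _ _ _) (.sub _ _ _ _)))), by norm_num, ?_, ?_, ?_, ?_, ?_, ?_, ?_⟩
      · simp [RAMState.setReg, h6, hF.arr0, hq]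
      · repeat' first | exact hF | refine Frame.setReg ?_ (by norm_num) _ | refine Frame.setArr ?_ _ _
      · simp [RAMState.setReg, RAMState.setArr, h4]
      · simp [RAMState.setReg, RAMState.setArr, h5]
      · simp [RAMState.setReg, RAMState.setArr, h8, hF.reg3]; omega
      · simp [RAMState.setReg, RAMState.setArr, h9, hF.reg3, e1]
      · simp [RAMState.setReg, RAMState.setArr, h6, hF.reg3, e2]; omega
      · intro k hk
        have := hacc k hk
        by_cases hkl : k = l
        · subst hkl
          simp [RAMState.setReg, RAMState.setArr, h9, hF.reg3, hl5, hq]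
        · have hle : l + 1 ≤ k ↔ l ≤ k := by omega
          simp [RAMState.setReg, RAMState.setArr, h9, this, hle, hkl])
    (by rintro s ⟨-, -, -, h8, -⟩; omega)
    ⟨hF, rfl, rfl, by simp [h8], h9, by simp [h6], fun k hk => by simp [hacc k hk]⟩
  refine ⟨t, s', h, by simp at ht; omega, hI.1, hI.2.1, hI.2.2.1, fun k hk => ?_⟩
  rw [hI.2.2.2.2.2.2 k hk]
  have : ¬ n ≤ k := by omega
  simp [this]

/-- Finding the address costs at most `3n + 1`, adding the row `9n + 1`, and four assignments are
needed. -/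
theorem runs_addRowAt (hW : 10 * (n + 1) ^ 2 ≤ W) (F : ℕ → ℕ) {j : ℕ} (hj : pos j ≤ n)
    {s : RAMState} (hF : Frame n m ρ q d₁ d₂ b pos s) (h5 : s.reg 5 = j)
    (hacc : ∀ k < n, s.arr 5 k = F k) :
    Runs W addRowAt s (12 * n + 6) fun s' => Frame n m ρ q d₁ d₂ b pos s' ∧ s'.reg 4 = s.reg 4 ∧
      s'.reg 5 = j ∧ ∀ k < n, s'.arr 5 k = if q (pos j * n + k) = 0 then F k else 1 - F k := by
  have hW' : 10 * (n * n) + 20 * n + 10 ≤ W := by nlinarith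
  let I : ℕ → RAMState → Prop := fun l s' => Frame n m ρ q d₁ d₂ b pos s' ∧ s'.reg 4 = s.reg 4 ∧
    s'.reg 5 = j ∧ s'.reg 8 = pos j - l ∧ s'.reg 6 = l * n ∧ ∀ k < n, s'.arr 5 k = F k
  refine Runs.seq (T₁ := 2) (Φ := I 0) ⟨_, _, by repeat' constructor, by norm_num, ?_⟩ ?_
    (T₂ := 12 * n + 4) (by omega)
  · refine ⟨?_, ?_, ?_, ?_, ?_, ?_⟩
    · repeat' first | exact hF | refine Frame.setReg ?_ (by norm_num) _
    · simp [RAMState.setReg]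
    · simp [RAMState.setReg, h5]
    · simp [RAMState.setReg, h5, hF.arr4]
    · simp [RAMState.setReg]
    · simpa [RAMState.setReg] using hacc
  intro s₁ hs₁
  refine Runs.seq (T₁ := 3 * n + 1) (Φ := I (pos j)) ?_ ?_ (T₂ := 9 * n + 3) (by omega)
  · obtain ⟨t, s', h, ht, hI⟩ := Runs.loop (W := W) (r := 8) (N := pos j) (I := I)
      (T := fun _ => 2) (s := s₁) (p := .seq (.add 6 6 0) (.sub 8 8 3)) (by
      rintro l hl s' ⟨hF, h4, h5, h8, h6, hacc⟩
      have hln : l * n ≤ n * n := Nat.mul_le_mul_right n (by omega)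
      have e1 : (l * n + n) % W = l * n + n := Nat.mod_eq_of_lt (by omega)
      refine ⟨by omega, _, _, by repeat' constructor, by norm_num, ?_, ?_, ?_, ?_, ?_, ?_⟩
      · repeat' first | exact hF | refine Frame.setReg ?_ (by norm_num) _
      · simp [RAMState.setReg, h4]
      · simp [RAMState.setReg, h5]
      · simp [RAMState.setReg, h8, hF.reg3]; omega
      · simp [RAMState.setReg, h6, hF.reg0, e1]; ring
      · simpa [RAMState.setReg] using hacc)
      (by rintro s ⟨-, -, -, h8, -⟩; omega) hs₁
    refine ⟨t, s', h, ?_, hI⟩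
    simp at ht; omega
  rintro s₂ ⟨hF, h4, h5, h8, h6, hacc⟩
  refine Runs.seq (T₁ := 2) (Φ := fun s' => Frame n m ρ q d₁ d₂ b pos s' ∧ s'.reg 4 = s.reg 4 ∧
      s'.reg 5 = j ∧ s'.reg 8 = n ∧ s'.reg 9 = 0 ∧ s'.reg 6 = pos j * n ∧
      ∀ k < n, s'.arr 5 k = F k) ⟨_, _, by repeat' constructor, by norm_num, ?_⟩ ?_
    (T₂ := 9 * n + 1) (by omega)
  · refine ⟨?_, ?_, ?_, ?_, ?_, ?_, ?_⟩
    · repeat' first | exact hF | refine Frame.setReg ?_ (by norm_num) _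
    · simp [RAMState.setReg, h4]
    · simp [RAMState.setReg, h5]
    · simp [RAMState.setReg, hF.reg0]
    · simp [RAMState.setReg]
    · simp [RAMState.setReg, h6]
    · simpa [RAMState.setReg] using hacc
  rintro s₃ ⟨hF, h4, h5, h8, h9, h6, hacc⟩
  obtain ⟨t, s', h, ht, r1, r2, r3, r4⟩ := runs_addRow hW F hj hF h8 h9 h6 hacc
  exact ⟨t, s', h, ht, r1, r2.trans h4, r3.trans h5, r4⟩

/-- The contents of the accumulator after `j` output bits have been processed. -/
def partialLinear (n : ℕ) (q d₂ b pos : ℕ → ℕ) : ℕ → ℕ → ℕ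
  | 0, k => d₂ (k * (n + 1))
  | j + 1, k =>
    if b j = 0 ∨ q (pos j * n + k) = 0 then partialLinear n q d₂ b pos j k
    else 1 - partialLinear n q d₂ b pos j k

/-- Each output bit costs a constant, and only the ones pay for a row of `Q`. -/
theorem runs_addRows (hW : 10 * (n + 1) ^ 2 ≤ W) (hm : m ≤ n) (hpos : ∀ j < m, pos j ≤ n)
    {s : RAMState} (hF : Frame n m ρ q d₁ d₂ b pos s)
    (hacc : ∀ k < n, s.arr 5 k = d₂ (k * (n + 1))) :
    Runs W addRows s (6 * m + ((Finset.range m).filter fun j => b j ≠ 0).card * (12 * n + 6) + 3)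
      fun s' => Frame n m ρ q d₁ d₂ b pos s' ∧
        ∀ k < n, s'.arr 5 k = partialLinear n q d₂ b pos m k := by
  have hW' : 10 * (n * n) + 20 * n + 10 ≤ W := by nlinarith
  let I : ℕ → RAMState → Prop := fun j s' => Frame n m ρ q d₁ d₂ b pos s' ∧ s'.reg 4 = m - j ∧
    s'.reg 5 = j ∧ ∀ k < n, s'.arr 5 k = partialLinear n q d₂ b pos j k
  refine Runs.seq (T₁ := 2) (Φ := I 0) ⟨_, _, by repeat' constructor, by norm_num, ?_⟩ ?_
    (T₂ := 6 * m + ((Finset.range m).filter fun j => b j ≠ 0).card * (12 * n + 6) + 1) (by omega)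
  · refine ⟨?_, ?_, ?_, ?_⟩
    · repeat' first | exact hF | refine Frame.setReg ?_ (by norm_num) _
    · simp [RAMState.setReg, hF.reg1]
    · simp [RAMState.setReg]
    · simpa [RAMState.setReg, partialLinear] using hacc
  intro s₁ hs₁
  obtain ⟨t, s', h, ht, hI⟩ := Runs.loop (W := W) (r := 4) (N := m) (I := I)
    (T := fun j => 5 + if b j ≠ 0 then 12 * n + 6 else 0) (s := s₁)
    (p := .seq (.load 7 3 5) <| .seq (.cond 7 addRowAt .skip) <| .seq (.add 5 5 3) (.sub 4 4 3)) (by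
    rintro j hj s ⟨hF, h4, h5, hacc⟩
    have e1 : (j + 1) % W = j + 1 := Nat.mod_eq_of_lt (by omega)
    refine ⟨by omega, ?_⟩
    refine Runs.seq (T₁ := 1) (Φ := fun s' => Frame n m ρ q d₁ d₂ b pos s' ∧ s'.reg 4 = m - j ∧
      s'.reg 5 = j ∧ s'.reg 7 = b j ∧ ∀ k < n, s'.arr 5 k = partialLinear n q d₂ b pos j k)
      ⟨_, _, .load _ _ _ _, le_rfl, ?_⟩ ?_ (T₂ := 4 + if b j ≠ 0 then 12 * n + 6 else 0) (by omega)
    · refine ⟨hF.setReg (by norm_num) _, ?_, ?_, ?_, ?_⟩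
      · simp [RAMState.setReg, h4]
      · simp [RAMState.setReg, h5]
      · simp [RAMState.setReg, h5, hF.arr3]
      · simpa [RAMState.setReg] using hacc
    rintro s ⟨hF, h4, h5, h7, hacc⟩
    refine Runs.seq (T₁ := (1 + if b j ≠ 0 then 12 * n + 6 else 0) + 1)
      (Φ := fun s' => Frame n m ρ q d₁ d₂ b pos s' ∧ s'.reg 4 = m - j ∧
        s'.reg 5 = j ∧ ∀ k < n, s'.arr 5 k = partialLinear n q d₂ b pos (j + 1) k)
      (Runs.cond (fun hr => ?_) fun hr => ?_) ?_ (T₂ := 2) (by omega)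
    · obtain ⟨t, s', h, ht, r1, r2, r3, r4⟩ := runs_addRowAt hW _ (hpos j hj) hF h5 hacc
      rw [h7] at hr
      refine ⟨t, s', h, by rw [if_pos hr]; omega, r1, r2.trans h4, r3, fun k hk => ?_⟩
      rw [r4 k hk]
      simp [partialLinear, hr]
    · rw [h7] at hr
      refine ⟨_, _, .skip _, by omega, hF, h4, h5, fun k hk => ?_⟩
      rw [hacc k hk]
      simp [partialLinear, hr]
    rintro s ⟨hF, h4, h5, hacc⟩
    refine ⟨_, _, by repeat' constructor, by norm_num, ?_, ?_, ?_, ?_⟩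
    · repeat' first | exact hF | refine Frame.setReg ?_ (by norm_num) _
    · simp [RAMState.setReg, h4, hF.reg3]; omega
    · simp [RAMState.setReg, h5, hF.reg3, e1]
    · simpa [RAMState.setReg] using hacc)
    (by rintro s ⟨-, h4, -⟩; omega) hs₁
  refine ⟨t, s', h, ht.trans (le_of_eq ?_), hI.1, hI.2.2.2⟩
  rw [Finset.sum_add_distrib, Finset.sum_add_distrib, ← Finset.sum_filter]
  simp only [Finset.sum_const, Finset.card_range, smul_eq_mul]
  ring

/-- The entries of `D₁` that decide whether row `k` vanishes. -/
def rowWeight (n : ℕ) (d₁ : ℕ → ℕ) (k : ℕ) : ℕ :=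
  d₁ (k * (n + 1)) + d₁ (k * (n + 1) + 1) + d₁ (k * (n + 1) - n)

theorem runs_scanRows (hW : 10 * (n + 1) ^ 2 ≤ W) (hd : ∀ a, d₁ a ≤ 1) (F : ℕ → ℕ)
    {s : RAMState} (hF : Frame n m ρ q d₁ d₂ b pos s) (hacc : ∀ k < n, s.arr 5 k = F k) :
    Runs W scanRows s (17 * n + 6) fun s' => Frame n m ρ q d₁ d₂ b pos s' ∧
      s'.reg 12 ≤ 1 ∧ (s'.reg 12 = 1 ↔ ∃ k < n, rowWeight n d₁ k = 0 ∧ F k ≠ 0) ∧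
      s'.reg 13 = Nat.count (fun k => rowWeight n d₁ k ≠ 0) n := by
  have hW' : 10 * (n * n) + 20 * n + 10 ≤ W := by nlinarith
  have hW1 : 1 % W = 1 := Nat.mod_eq_of_lt (by omega)
  let I : ℕ → RAMState → Prop := fun i s' => Frame n m ρ q d₁ d₂ b pos s' ∧ s'.reg 4 = n - i ∧
    s'.reg 5 = i ∧ s'.reg 6 = i * (n + 1) ∧ (∀ k < n, s'.arr 5 k = F k) ∧
    s'.reg 12 ≤ 1 ∧ (s'.reg 12 = 1 ↔ ∃ k < i, rowWeight n d₁ k = 0 ∧ F k ≠ 0) ∧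
    s'.reg 13 = Nat.count (fun k => rowWeight n d₁ k ≠ 0) i
  refine Runs.seq (T₁ := 5) (Φ := I 0) ⟨_, _, by repeat' constructor, by norm_num, ?_⟩ ?_
    (T₂ := 17 * n + 1) (by omega)
  · refine ⟨?_, ?_, ?_, ?_, ?_, ?_, ?_, ?_⟩
    · repeat' first | exact hF | refine Frame.setReg ?_ (by norm_num) _
    · simp [RAMState.setReg, hF.reg0]
    · simp [RAMState.setReg]
    · simp [RAMState.setReg]
    · simpa [RAMState.setReg] using hacc
    · simp [RAMState.setReg]
    · simp [RAMState.setReg]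
    · simp [RAMState.setReg]
  intro s₁ hs₁
  obtain ⟨t, s', h, ht, hI⟩ := Runs.loop (W := W) (r := 4) (N := n) (I := I)
    (T := fun _ => 16) (s := s₁)
    (p := .seq (.seq (.load 7 1 6) <| .seq (.add 8 6 3) <| .seq (.load 8 1 8) <|
        .seq (.add 7 7 8) <| .seq (.sub 8 6 0) <| .seq (.load 8 1 8) <| .add 7 7 8) <|
      .seq (.cond 7 (.add 13 13 3) (.seq (.load 8 5 5) (.cond 8 (.const 12 1) .skip))) <|
      .seq (.add 5 5 3) <| .seq (.add 6 6 0) <| .seq (.add 6 6 3) <| .sub 4 4 3) (by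
    rintro i hi s ⟨hF, h4, h5, h6, hacc, h12, hbad, h13⟩
    have hin : i * n ≤ n * n := Nat.mul_le_mul_right n hi.le
    have e1 : (i + 1) % W = i + 1 := Nat.mod_eq_of_lt (by omega)
    have e2 : (i * (n + 1) + n) % W = i * (n + 1) + n := Nat.mod_eq_of_lt (by
      rw [mul_add]; omega)
    have e3 : (i * (n + 1) + n + 1) % W = i * (n + 1) + n + 1 := Nat.mod_eq_of_lt (by
      rw [mul_add]; omega)
    have e4 : (i * (n + 1) + 1) % W = i * (n + 1) + 1 := Nat.mod_eq_of_lt (by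
      rw [mul_add]; omega)
    refine ⟨by omega, ?_⟩
    refine Runs.seq (T₁ := 7) (Φ := fun s' => Frame n m ρ q d₁ d₂ b pos s' ∧ s'.reg 4 = n - i ∧
      s'.reg 5 = i ∧ s'.reg 6 = i * (n + 1) ∧ s'.reg 7 = rowWeight n d₁ i ∧
      (∀ k < n, s'.arr 5 k = F k) ∧
      s'.reg 12 ≤ 1 ∧ (s'.reg 12 = 1 ↔ ∃ k < i, rowWeight n d₁ k = 0 ∧ F k ≠ 0) ∧
      s'.reg 13 = Nat.count (fun k => rowWeight n d₁ k ≠ 0) i)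
      ⟨_, _, by repeat' constructor, by norm_num, ?_⟩ ?_ (T₂ := 9) (by omega)
    · refine ⟨?_, ?_, ?_, ?_, ?_, ?_, ?_, ?_, ?_⟩
      · repeat' first | exact hF | refine Frame.setReg ?_ (by norm_num) _
      · simp [RAMState.setReg, h4]
      · simp [RAMState.setReg, h5]
      · simp [RAMState.setReg, h6]
      · have hd0 := hd (i * (n + 1))
        have hd1 := hd (i * (n + 1) + 1)
        have hd2 := hd (i * (n + 1) - n)
        -- Three bits add up to at most 3, so the sum does not wrap to zero.
        have f2 : (d₁ (i * (n + 1)) + d₁ (i * (n + 1) + 1) + d₁ (i * (n + 1) - n)) % W =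
          d₁ (i * (n + 1)) + d₁ (i * (n + 1) + 1) + d₁ (i * (n + 1) - n) :=
          Nat.mod_eq_of_lt (by omega)
        simp only [RAMState.setReg, Function.update_apply, h6, hF.reg0, hF.reg3, hF.arr1]
        norm_num
        rw [e4, f2, rowWeight]
      · simpa [RAMState.setReg] using hacc
      · simpa [RAMState.setReg] using h12
      · simpa [RAMState.setReg] using hbad
      · simpa [RAMState.setReg] using h13
    rintro s ⟨hF, h4, h5, h6, h7, hacc, h12, hbad, h13⟩
    refine Runs.seq (T₁ := 4 + 1) (Φ := fun s' => Frame n m ρ q d₁ d₂ b pos s' ∧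
      s'.reg 4 = n - i ∧ s'.reg 5 = i ∧ s'.reg 6 = i * (n + 1) ∧
      (∀ k < n, s'.arr 5 k = F k) ∧
      s'.reg 12 ≤ 1 ∧ (s'.reg 12 = 1 ↔ ∃ k < i + 1, rowWeight n d₁ k = 0 ∧ F k ≠ 0) ∧
      s'.reg 13 = Nat.count (fun k => rowWeight n d₁ k ≠ 0) (i + 1))
      (Runs.cond (fun hr => ?_) fun hr => ?_) ?_ (T₂ := 4) (by omega)
    · rw [h7] at hr
      have hc : Nat.count (fun k => rowWeight n d₁ k ≠ 0) i ≤ i := Nat.count_le _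
      have e5 : (Nat.count (fun k => rowWeight n d₁ k ≠ 0) i + 1) % W =
        Nat.count (fun k => rowWeight n d₁ k ≠ 0) i + 1 := Nat.mod_eq_of_lt (by omega)
      refine ⟨_, _, .add _ _ _ _, by norm_num, hF.setReg (by norm_num) _, ?_, ?_, ?_, ?_, ?_, ?_,
        ?_⟩
      · simp [RAMState.setReg, h4]
      · simp [RAMState.setReg, h5]
      · simp [RAMState.setReg, h6]
      · simpa [RAMState.setReg] using hacc
      · simpa [RAMState.setReg] using h12
      · simp only [Nat.lt_succ_iff_lt_or_eq, or_and_right, exists_or, exists_eq_left, hr, false_and,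
          or_false]
        simpa [RAMState.setReg] using hbad
      · rw [Nat.count_succ, if_pos hr]
        simp only [RAMState.setReg, Function.update_self, h13, hF.reg3, e5]
    · rw [h7] at hr
      have hcount : Nat.count (fun k => rowWeight n d₁ k ≠ 0) (i + 1) =
          Nat.count (fun k => rowWeight n d₁ k ≠ 0) i := by
        rw [Nat.count_succ, if_neg (by simpa using hr), add_zero]
      by_cases hFi : F i = 0
      · refine ⟨_, _, .seq (.load _ _ _ _) (.cond_false ?_ (.skip _)), by norm_num,
          hF.setReg (by norm_num) _, ?_, ?_, ?_, ?_, ?_, ?_, ?_⟩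
        · simp [RAMState.setReg, h5, hacc i hi, hFi]
        · simp [RAMState.setReg, h4]
        · simp [RAMState.setReg, h5]
        · simp [RAMState.setReg, h6]
        · simpa [RAMState.setReg] using hacc
        · simpa [RAMState.setReg] using h12
        · simp only [Nat.lt_succ_iff_lt_or_eq, or_and_right, exists_or, exists_eq_left, hFi, ne_eq,
            not_true, and_false, or_false]
          simpa [RAMState.setReg] using hbad
        · rw [hcount]
          simpa [RAMState.setReg] using h13
      · refine ⟨_, _, .seq (.load _ _ _ _) (.cond_true ?_ (.const _ _ _)), by norm_num,
          (hF.setReg (by norm_num) _).setReg (by norm_num) _, ?_, ?_, ?_, ?_, ?_, ?_, ?_⟩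
        · simp [RAMState.setReg, h5, hacc i hi, hFi]
        · simp [RAMState.setReg, h4]
        · simp [RAMState.setReg, h5]
        · simp [RAMState.setReg, h6]
        · simpa [RAMState.setReg] using hacc
        · simp [RAMState.setReg, hW1]
        · simp only [RAMState.setReg, Function.update_self, hW1, true_iff]
          exact ⟨i, by omega, hr, hFi⟩
        · rw [hcount]
          simpa [RAMState.setReg] using h13
    rintro s ⟨hF, h4, h5, h6, hacc, h12, hbad, h13⟩
    refine ⟨_, _, by repeat' constructor, by norm_num, ?_, ?_, ?_, ?_, ?_, ?_, ?_, ?_⟩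
    · repeat' first | exact hF | refine Frame.setReg ?_ (by norm_num) _
    · simp [RAMState.setReg, h4, hF.reg3]; omega
    · simp [RAMState.setReg, h5, hF.reg3, e1]
    · simp [RAMState.setReg, h6, hF.reg3, hF.reg0, e2, e3]; ring
    · simpa [RAMState.setReg] using hacc
    · simpa [RAMState.setReg] using h12
    · simpa [RAMState.setReg] using hbad
    · simpa [RAMState.setReg] using h13)
    (by rintro s ⟨-, h4, -⟩; omega) hs₁
  refine ⟨t, s', h, ?_, hI.1, hI.2.2.2.2.2⟩
  simp at ht; omega

theorem runs_amplitudeProg (hW : 10 * (n + 1) ^ 2 ≤ W) (hm : m ≤ n) (hρ : ρ ≤ 2 * n)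
    (hpos : ∀ j < m, pos j ≤ n) (hd : ∀ a, d₁ a ≤ 1) {s : RAMState} (h0 : s.reg 0 = n)
    (h1 : s.reg 1 = m) (h2 : s.reg 2 = ρ) (a0 : s.arr 0 = q) (a1 : s.arr 1 = d₁)
    (a2 : s.arr 2 = d₂) (a3 : s.arr 3 = b) (a4 : s.arr 4 = pos) :
    Runs W amplitudeProg s
      (100 * ((((Finset.range m).filter fun j => b j ≠ 0).card + 1) * n + 1)) fun s' =>
      (s'.reg 0 = 0 ↔ ∃ k < n, rowWeight n d₁ k = 0 ∧ partialLinear n q d₂ b pos m k ≠ 0) ∧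
      s'.reg 1 = ρ + Nat.count (fun k => rowWeight n d₁ k ≠ 0) n - 2 * n := by
  have hW' : 10 * (n * n) + 20 * n + 10 ≤ W := by nlinarith
  have he : ((Finset.range m).filter fun j => b j ≠ 0).card ≤ n :=
    ((Finset.card_filter_le _ _).trans (Finset.card_range m).le).trans hm
  set e := ((Finset.range m).filter fun j => b j ≠ 0).card with he'
  refine Runs.seq (runs_initLinear hW h0 h1 h2 a0 a1 a2 a3 a4) ?_
    -- The terms `6m` and `6e` are absorbed by multiples of `n`, as `e ≤ n` and `m ≤ n`.
    (T₂ := 6 * m + e * (12 * n + 6) + 3 + (17 * n + 6 + 4)) (by nlinarith)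
  rintro s₁ ⟨hF, hacc⟩
  refine Runs.seq (runs_addRows hW hm hpos hF hacc) ?_ le_rfl
  rintro s₂ ⟨hF, hacc⟩
  refine Runs.seq (runs_scanRows hW hd _ hF hacc) ?_ le_rfl
  rintro s₃ ⟨hF, h12, hbad, h13⟩
  have hc : Nat.count (fun k => rowWeight n d₁ k ≠ 0) n ≤ n := Nat.count_le _
  have e1 : (ρ + Nat.count (fun k => rowWeight n d₁ k ≠ 0) n) % W =
    ρ + Nat.count (fun k => rowWeight n d₁ k ≠ 0) n := Nat.mod_eq_of_lt (by omega)
  generalize Nat.count (fun k => rowWeight n d₁ k ≠ 0) n = c at *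
  refine ⟨_, _, by repeat' constructor, by norm_num, ?_, ?_⟩
  · rw [← hbad]
    simp [RAMState.setReg, hF.reg3]
    omega
  · simp only [RAMState.setReg, Function.update_apply, h13, hF.reg2, hF.reg0]
    norm_num
    rw [e1]
    omega

end Correctness

/-! ### From arrays back to matrices -/

theorem matrixArray_apply {n : ℕ} (M : Matrix (Fin n) (Fin n) (ZMod 2)) (i j : Fin n) :
    matrixArray M (i * n + j) = (M i j).val := by
  have h0 : 0 < n := i.pos
  have h1 : ((i : ℕ) * n + j) / n = i := by
    rw [mul_comm, Nat.mul_add_div h0, Nat.div_eq_of_lt j.2, add_zero]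
  have h2 : ((i : ℕ) * n + j) % n = j := by
    rw [mul_comm, Nat.mul_add_mod, Nat.mod_eq_of_lt j.2]
  simp only [matrixArray, h1, h2, Fin.is_lt, and_self, dif_pos, Fin.eta]

theorem matrixArray_le_one {n : ℕ} (M : Matrix (Fin n) (Fin n) (ZMod 2)) (a : ℕ) :
    matrixArray M a ≤ 1 := by
  rw [matrixArray]
  split_ifs
  · exact Nat.lt_succ_iff.1 (ZMod.val_lt _)
  · exact zero_le_one

theorem vectorArray_apply {m : ℕ} (v : Fin m → ℕ) (j : Fin m) : vectorArray v j = v j := by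
  simp [vectorArray]

theorem card_filter_univ_fin {m : ℕ} (p : ℕ → Prop) [DecidablePred p] :
    (Finset.univ.filter fun j : Fin m => p j).card = ((Finset.range m).filter p).card := by
  rw [Finset.card_filter, Finset.card_filter, Finset.sum_range]

/-- The only possible one of row `k` lies at `π k`, hence on the diagonal or next to it. -/
theorem rowWeight_eq_zero_iff {n : ℕ} {D : Matrix (Fin n) (Fin n) (ZMod 2)} (hD : IsInvolutive D)
    (k : Fin n) : rowWeight n (matrixArray D) k = 0 ↔ IsZeroRow D k := by
  have hsymm := hD.isSymm
  obtain ⟨π, p, -, -, hπ, hp⟩ := hD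
  have hdiag : matrixArray D (k * (n + 1)) = (D k k).val := by
    rw [← matrixArray_apply, mul_add, mul_one]
  have hright : ∀ l : Fin n, (l : ℕ) = k + 1 → matrixArray D (k * (n + 1) + 1) = (D k l).val := by
    intro l hl
    rw [← matrixArray_apply, hl]
    congr 1
  have hleft : ∀ l : Fin n, (k : ℕ) = l + 1 → matrixArray D (k * (n + 1) - n) = (D k l).val := by
    intro l hl
    rw [← hsymm.apply k l, ← matrixArray_apply, hl]
    congr 1
    rw [Nat.sub_eq_iff_eq_add (by nlinarith)]
    ring
  rw [rowWeight, Nat.add_eq_zero_iff, Nat.add_eq_zero_iff]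
  constructor
  · rintro ⟨⟨h1, h2⟩, h3⟩
    by_contra hrow
    have hk : p k := by
      by_contra hk
      exact hrow ((IsInvolutive.row_eq_zero_iff hp k).2 hk)
    have h11 : (D k (π k)).val ≠ 0 := by rw [(hp k _).2 ⟨hk, rfl⟩]; decide
    obtain ⟨ha, hb⟩ := hπ k
    rcases lt_trichotomy (π k : ℕ) k with h | h | h
    · exact h11 (hleft (π k) (by omega) ▸ h3)
    · rw [hdiag] at h1
      rw [Fin.ext h] at h11
      exact h11 h1
    · exact h11 (hright (π k) (by omega) ▸ h2)
  · intro hrow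
    refine ⟨⟨by rw [hdiag, hrow, ZMod.val_zero], ?_⟩, ?_⟩
    · by_cases hk : (k : ℕ) + 1 < n
      · rw [hright ⟨k + 1, hk⟩ rfl, hrow, ZMod.val_zero]
      · have hk' : (k : ℕ) + 1 = n := by omega
        have : (k : ℕ) * (n + 1) + 1 = n * n := by nlinarith
        rw [this, matrixArray, dif_neg]
        rw [Nat.mul_div_cancel _ k.pos]
        simp
    · by_cases hk : (k : ℕ) = 0
      -- In row 0 truncated subtraction reads the diagonal entry again.
      · have : (k : ℕ) * (n + 1) - n = k * (n + 1) := by simp [hk]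
        rw [this, hdiag, hrow, ZMod.val_zero]
      · rw [hleft ⟨k - 1, by omega⟩ (by simp; omega), hrow, ZMod.val_zero]

theorem count_rowWeight {n : ℕ} {D : Matrix (Fin n) (Fin n) (ZMod 2)} (hD : IsInvolutive D) :
    Nat.count (fun k => rowWeight n (matrixArray D) k ≠ 0) n = D.rank := by
  rw [rank_eq_card hD.mul_self, Nat.count_eq_card_filter_range, ← card_filter_univ_fin,
    Fintype.card_subtype]
  simp only [ne_eq, rowWeight_eq_zero_iff hD]

/-- On bits, `1 - v` is addition of one modulo 2, so the accumulator follows the partial sums of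
`linearPart`. -/
theorem partialLinear_eq {m n : ℕ} (Q D₂ : Matrix (Fin n) (Fin n) (ZMod 2)) (b : Fin m → ZMod 2)
    (pos : Fin m → Fin n) (k : Fin n) :
    partialLinear n (matrixArray Q) (matrixArray D₂) (vectorArray fun j => (b j).val)
      (vectorArray fun j => (pos j : ℕ)) m k = (linearPart Q D₂ pos b k).val := by
  rw [linearPart, Finset.sum_fin_eq_sum_range]
  have key : ∀ j ≤ m, partialLinear n (matrixArray Q) (matrixArray D₂)
      (vectorArray fun j => (b j).val) (vectorArray fun j => (pos j : ℕ)) j k =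
      (D₂ k k + ∑ i ∈ Finset.range j,
        if h : i < m then b ⟨i, h⟩ * Q (pos ⟨i, h⟩) k else 0).val := by
    intro j hj
    induction j with
    | zero => rw [partialLinear, Finset.sum_range_zero, add_zero, ← matrixArray_apply, mul_add,
        mul_one]
    | succ j ih =>
      have hjm : j < m := by omega
      have h1 := vectorArray_apply (fun j => (b j).val) ⟨j, hjm⟩
      have h2 := vectorArray_apply (fun j => (pos j : ℕ)) ⟨j, hjm⟩
      dsimp only at h1 h2
      rw [partialLinear, ih (by omega), h1, h2, matrixArray_apply, Finset.sum_range_succ,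
        dif_pos hjm, ← add_assoc]
      generalize D₂ k k + _ = x
      generalize b ⟨j, hjm⟩ = y
      generalize Q (pos ⟨j, hjm⟩) k = z
      revert x y z
      decide
  exact key m le_rfl

end Stabilizer

/-! ### The theorem -/

theorem mainTheorem10 :
    ∃ (P : Stabilizer.Prog) (K : ℕ),
      ∀ (m : ℕ) (C : Stabilizer.Circuit m) (o : Stabilizer.OutputChoice C)
        (n : ℕ) (ord : Fin n ≃ o.FreeVar)
        (A : Matrix (Fin n) (Fin n) (ZMod 4)) (pos : Fin m → Fin n)
        (Q D₁ D₂ : Matrix (Fin n) (Fin n) (ZMod 2)),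
        o.IsPresentedBy ord A pos →
        Stabilizer.IsNormalForm A Q D₁ D₂ →
        ∀ b : Fin m → ZMod 2,
          (‖Stabilizer.amplitude C b 0‖ ^ 2 = 0 ↔
            ∃ k, (∀ l, D₁ k l = 0) ∧ Stabilizer.linearPart Q D₂ pos b k = 1) ∧
          (‖Stabilizer.amplitude C b 0‖ ^ 2 ≠ 0 →
            ‖Stabilizer.amplitude C b 0‖ ^ 2 =
              (2 : ℝ) ^ (2 * n - D₁.rank) / (2 : ℝ) ^ o.normExp) ∧
          ∀ W : ℕ, K * (n + 1) ^ 2 ≤ W →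
            ∃ (t : ℕ) (s : Stabilizer.RAMState),
              Stabilizer.Exec W P (Stabilizer.inputState o.normExp Q D₁ D₂ b pos) t s ∧
              Stabilizer.outputValue s = ‖Stabilizer.amplitude C b 0‖ ^ 2 ∧
              t ≤ K * ((Stabilizer.numOnes b + 1) * n + 1) := by
  refine ⟨Stabilizer.amplitudeProg, 100, ?_⟩
  intro m C o n ord A pos Q D₁ D₂ hA hN b
  have hsq := Stabilizer.norm_amplitude_sq_eq hA hN b
  have hzero : ‖Stabilizer.amplitude C b 0‖ ^ 2 = 0 ↔
      ∃ k, Stabilizer.IsZeroRow D₁ k ∧ Stabilizer.linearPart Q D₂ pos b k = 1 := by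
    rw [hsq]
    split_ifs with h
    · simp [h]
    · simp [h]
  refine ⟨hzero, fun h => ?_, fun W hW => ?_⟩
  · rwa [if_neg (fun h' => h (hzero.2 h'))] at hsq
  -- Injectivity of `pos` gives `m ≤ n`; this bounds the scan of `b`, and with `ρ = n + m` the
  -- exponent.
  have hmn : m ≤ n := by simpa using Fintype.card_le_of_injective pos hA.2.1
  have hρ : n + m = o.normExp := by
    rw [← o.card_freeVar_add, ← Fintype.card_congr ord, Fintype.card_fin]
  obtain ⟨t, s, hexec, ht, hs0, hs1⟩ := Stabilizer.runs_amplitudeProg (W := W) (n := n) (m := m)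
    (ρ := o.normExp) (q := Stabilizer.matrixArray Q) (d₁ := Stabilizer.matrixArray D₁)
    (d₂ := Stabilizer.matrixArray D₂) (b := Stabilizer.vectorArray fun j => (b j).val)
    (pos := Stabilizer.vectorArray fun j => (pos j : ℕ)) (by nlinarith) hmn (by omega)
    (fun j hj => by
      rw [Stabilizer.vectorArray, dif_pos hj]
      exact (pos ⟨j, hj⟩).2.le) (Stabilizer.matrixArray_le_one D₁)
    (s := Stabilizer.inputState o.normExp Q D₁ D₂ b pos) rfl rfl rfl rfl rfl rfl rfl rfl
  have hones : Stabilizer.numOnes b = ((Finset.range m).filter fun j =>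
      Stabilizer.vectorArray (fun j => (b j).val) j ≠ 0).card := by
    rw [← Stabilizer.card_filter_univ_fin, Stabilizer.numOnes]
    have key : ∀ a : ZMod 2, a.val ≠ 0 ↔ a = 1 := by decide
    simp only [Stabilizer.vectorArray_apply, key]
  have hs0' : s.reg 0 = 0 ↔
      ∃ k, Stabilizer.IsZeroRow D₁ k ∧ Stabilizer.linearPart Q D₂ pos b k = 1 := by
    have key : ∀ a : ZMod 2, a.val ≠ 0 ↔ a = 1 := by decide
    rw [hs0]
    constructor
    · rintro ⟨k, hk, h1, h2⟩
      refine ⟨⟨k, hk⟩, (Stabilizer.rowWeight_eq_zero_iff hN.isInvolutive ⟨k, hk⟩).1 h1, ?_⟩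
      rw [← key, ← Stabilizer.partialLinear_eq]
      exact h2
    · rintro ⟨k, h1, h2⟩
      refine ⟨k, k.2, (Stabilizer.rowWeight_eq_zero_iff hN.isInvolutive k).2 h1, ?_⟩
      rw [Stabilizer.partialLinear_eq, key, h2]
  refine ⟨t, s, hexec, ?_, by rw [hones]; exact ht⟩
  rw [Stabilizer.outputValue]
  split_ifs with h
  · exact (hzero.2 (hs0'.1 h)).symm
  · rw [hs0'] at h
    -- Since the amplitude has modulus at most 1, `2n ≤ ρ + r`, so the program's truncated
    -- subtraction is exact.
    have hle := Stabilizer.two_mul_sub_rank_le hA hN b h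
    have hrank : D₁.rank ≤ n := by simpa using D₁.rank_le_card_width
    rw [hsq, if_neg h, hs1, Stabilizer.count_rowWeight hN.isInvolutive]
    have : o.normExp = 2 * n - D₁.rank + (o.normExp + D₁.rank - 2 * n) := by omega
    rw [eq_div_iff (by positivity), inv_mul_eq_div, div_eq_iff (by positivity), ← pow_add, ← this]
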